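/- Setting. $(U,A,Z,W,Y,C)$ are random variables on a standard Borel probability space: $U$ is a latent confounder, $A$ the treatment, $Z$ and $W$ the treatment- and outcome-inducing proxies ($W$ takes values in a standard Borel space), $Y$ the real outcome, and $C$ the variable on which a measurable policy $\pi:\mathcal C\to\mathcal A$ acts. Assume $Y\perp Z\mid (A,U)$, $W\perp (A,Z)\mid U$ and $C\perp W\mid U$. The value of the policy is $v(\pi)=\mathbb E_{U,C}\big[\mathbb E[Y\mid A=\pi(C),U]\big]$, where the law of $(\pi(C),U)$ is assumed absolutely continuous with respect to that of $(A,U)$, so that $v(\pi)$ is well defined. Completeness. (a) For each treatment level, the confounder is complete: for measurable $l(a,u)$ with $\mathbb E[l(A,U)^2]<\infty$, $\mathbb E[l(A,U)\mid A,Z]=0$ a.s. iff $l(A,U)=0$ a.s. (b) For $l$ with $\mathbb E[l(W)^2]<\infty$, $\mathbb E[l(W)\mid A,Z]=0$ a.s. iff $l=0$ $P_W$-a.e. Let $h^*$ be a bridge function, that is, a jointly measurable function with $\mathbb E[h^*(A,W)^2]<\infty$ and $\mathbb E[Y\mid A,Z]=\mathbb E[h^*(A,W)\mid A,Z]$ a.s.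 Model. Let $\phi_{\theta_{A(1)}},\phi_{\theta_Z},\psi_{\theta_{A(2)}},\psi_{\theta_W}$ be finite-dimensional feature maps, measurable in the input and continuous in their real parameter vectors. The parameters $(V,\theta_{A(1)},\theta_Z)$, $(u,\theta_{A(2)})$ and $\theta_W$ range over given sets $\Theta_1$, $\Theta_2$, $\Theta_W$. The stage 1 predictions are $g(a,z)=V(\phi_{\theta_{A(1)}}(a)\otimes\phi_{\theta_Z}(z))$ and the bridge models are $h(a,w)=u^\top(\psi_{\theta_{A(2)}}(a)\otimes\psi_{\theta_W}(w))$. Put $$\mathcal H_1=\{(w,a,z)\mapsto\|\psi_{\theta_W}(w)-g(a,z)\|^2\},\qquad \mathcal H_2=\{(y,a,z)\mapsto (y-u^\top(\psi_{\theta_{A(2)}}(a)\otimes g(a,z)))^2\},$$ $$\kappa_1=\sup_{\theta_W}\inf_{g}\mathbb E\big\|\mathbb E[\psi_{\theta_W}(W)\mid A,Z]-g(A,Z)\big\|^2,\qquad \kappa_2=\inf_{h}\big\|\mathbb E[Y\mid A,Z]-\mathbb E[h(A,W)\mid A,Z]\big\|_{L^2}.$$ The empirical Rademacher complexity of a class $\mathcal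 G$ on a sample $S=(s_i)_{i\le n}$ is $\hat{\mathfrak R}_S(\mathcal G)=\mathbb E_\sigma\sup_{f\in\mathcal G}\frac1n\sum_i\sigma_i f(s_i)$, with $\sigma_i$ independent and uniform on $\{-1,1\}$. Boundedness, ill-posedness and policy conditions. Let $M\in\mathbb R$ and $\tau,\rho\in[0,\infty)$, and assume: 1. $|Y|\le M$ a.s., and everywhere $\|g(a,z)\|\le1$, $\|\psi_{\theta_W}(w)\|\le1$, and $v\mapsto u^\top(\psi_{\theta_{A(2)}}(a)\otimes v)$ has norm at most $M$; 2. for every $h$ in the model, $\|h^*-h\|_{L^2(P_{A,W})}\le\tau\,\|\mathbb E[(h^*-h)(A,W)\mid A,Z]\|_{L^2}$; 3. the law of $(\pi(C),W)$ has a density $r_\pi$ with respect to $P_{A,W}$, and $\|r_\pi\|_{L^2(P_{A,W})}\le\rho$. Estimator. Let $m,n,n'\ge1$, and let $S_1=\{(w_i,a_i,z_i)\}_{i=1}^m$, $S_2=\{(\tilde y_i,\tilde a_i,\tilde z_i)\}_{i=1}^n$ and $S_3=\{(\check c_i,\check w_i)\}_{i=1}^{n'}$ each be i.i.d. from the laws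 of $(W,A,Z)$, $(Y,A,Z)$ and $(C,W)$. For each $\theta_W$ let $\hat g_{\theta_W}$, with matrix $\hat V$, minimize $\frac1m\sum_i\|\psi_{\theta_W}(w_i)-g(a_i,z_i)\|^2+\lambda_1\|V\|^2$ over $\Theta_1$. Let $(\hat u,\hat\theta_{A(2)},\hat\theta_W)$ minimize $\frac1n\sum_i(\tilde y_i-u^\top(\psi_{\theta_{A(2)}}(\tilde a_i)\otimes\hat g_{\theta_W}(\tilde a_i,\tilde z_i)))^2+\lambda_2\|u\|^2$ over $\Theta_2\times\Theta_W$. The regularization is negligible: $\lambda_1,\lambda_2\ge0$, with $\lambda_1\|V\|^2\le m^{-1/2}$ and $\lambda_2\|u\|^2\le n^{-1/2}$ on the parameter sets (for example $\lambda_1=\lambda_2=0$). The sample $S_3$ is held out: $(\hat u,\hat\theta_{A(2)},\hat\theta_W)$ is measurable and independent of $S_3$. Put $$\hat v(\pi)=\frac1{n'}\sum_{i=1}^{n'}\hat u^\top\big(\psi_{\hat\theta_{A(2)}}(\pi(\check c_i))\otimes\psi_{\hat\theta_W}(\check w_i)\big).$$ Claim. Then $$|v(\pi)-\hat v(\pi)|\le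 O_p\left(\sqrt{\kappa_1+\hat{\mathfrak R}_{S_1}(\mathcal H_1)+\tfrac1{\sqrt m}}+\kappa_2+\sqrt{\hat{\mathfrak R}_{S_2}(\mathcal H_2)+\tfrac1{\sqrt n}}+\tfrac1{\sqrt{n'}}\right),$$ that is, for every $\delta>0$ there is a constant $K$ such that for all $m,n,n'\ge1$ the left side exceeds $K$ times the bracket with probability at most $\delta$. For given underlying spaces, $K$ depends only on $\delta,M,\tau,\rho$, and not on the distributions, the model, the policy or the sample sizes. -/

import Mathlib

open MeasureTheory ProbabilityTheory
open scoped ENNReal NNReal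

namespace DFPV

noncomputable section

/-- One draw from the population: the latent confounder `U`, the treatment `A`, the
treatment-inducing proxy `Z`, the outcome-inducing proxy `W`, the outcome `Y`, and the variable
`C` on which a policy acts. -/
structure Population (Ω 𝒰 𝒜 𝒵 𝒲 𝒞 : Type*) [MeasurableSpace Ω] [MeasurableSpace 𝒰]
    [MeasurableSpace 𝒜] [MeasurableSpace 𝒵] [MeasurableSpace 𝒲] [MeasurableSpace 𝒞] where
  μ : Measure Ω
  prob : IsProbabilityMeasure μ
  U : Ω → 𝒰
  A : Ω → 𝒜
  Z : Ω → 𝒵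
  W : Ω → 𝒲
  Y : Ω → ℝ
  C : Ω → 𝒞
  measurable_U : Measurable U
  measurable_A : Measurable A
  measurable_Z : Measurable Z
  measurable_W : Measurable W
  measurable_Y : Measurable Y
  measurable_C : Measurable C

attribute [instance] Population.prob

namespace Population

variable {Ω 𝒰 𝒜 𝒵 𝒲 𝒞 : Type*} [MeasurableSpace Ω] [MeasurableSpace 𝒰]
  [MeasurableSpace 𝒜] [MeasurableSpace 𝒵] [MeasurableSpace 𝒲] [MeasurableSpace 𝒞]

/-- `Y ⟂ Z | (A, U)` and `W ⟂ (A, Z) | U`. -/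
def Structural [StandardBorelSpace Ω] (P : Population Ω 𝒰 𝒜 𝒵 𝒲 𝒞) : Prop :=
  CondIndepFun (MeasurableSpace.comap (fun ω => (P.A ω, P.U ω)) inferInstance)
      (P.measurable_A.prodMk P.measurable_U).comap_le P.Y P.Z P.μ ∧
    CondIndepFun (MeasurableSpace.comap P.U inferInstance)
      P.measurable_U.comap_le P.W (fun ω => (P.A ω, P.Z ω)) P.μ

/-- `C ⟂ W | U`. -/
def PolicyVariableIndep [StandardBorelSpace Ω] (P : Population Ω 𝒰 𝒜 𝒵 𝒲 𝒞) : Prop :=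
  CondIndepFun (MeasurableSpace.comap P.U inferInstance)
    P.measurable_U.comap_le P.C P.W P.μ

/-- The σ-algebra generated by `(A, Z)`. -/
abbrev sigmaAZ (P : Population Ω 𝒰 𝒜 𝒵 𝒲 𝒞) : MeasurableSpace Ω :=
  MeasurableSpace.comap (fun ω => (P.A ω, P.Z ω)) inferInstance

/-- Completeness on the confounder: at every treatment level `a` (up to null sets), the only
square-integrable `l(a, ·)` with `E[l(a, U) | A = a, Z] = 0` is zero. The functions at all levels
`a` are collected in one measurable `l(a, u)`. -/
def ConfounderComplete (P : Population Ω 𝒰 𝒜 𝒵 𝒲 𝒞) : Prop :=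
  ∀ l : 𝒜 × 𝒰 → ℝ, Measurable l → MemLp (fun ω => l (P.A ω, P.U ω)) 2 P.μ →
    (P.μ[fun ω => l (P.A ω, P.U ω) | P.sigmaAZ] =ᵐ[P.μ] 0 ↔
      (fun ω => l (P.A ω, P.U ω)) =ᵐ[P.μ] 0)

/-- Completeness on the outcome-inducing proxy: for square-integrable `l : 𝒲 → ℝ`,
`E[l(W) | A, Z] = 0` if and only if `l = 0` almost everywhere for the law of `W`. -/
def ProxyComplete (P : Population Ω 𝒰 𝒜 𝒵 𝒲 𝒞) : Prop :=
  ∀ l : 𝒲 → ℝ, Measurable l → MemLp l 2 (P.μ.map P.W) →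
    (P.μ[fun ω => l (P.W ω) | P.sigmaAZ] =ᵐ[P.μ] 0 ↔ l =ᵐ[P.μ.map P.W] 0)

/-- `h` is a bridge function: jointly measurable, square-integrable, and
`E[Y | A, Z] = E[h(A, W) | A, Z]`. -/
def IsBridge (P : Population Ω 𝒰 𝒜 𝒵 𝒲 𝒞) (h : 𝒜 × 𝒲 → ℝ) : Prop :=
  Measurable h ∧ MemLp (fun ω => h (P.A ω, P.W ω)) 2 P.μ ∧
    P.μ[P.Y | P.sigmaAZ] =ᵐ[P.μ] P.μ[fun ω => h (P.A ω, P.W ω) | P.sigmaAZ]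

/-- The regression function `(a, u) ↦ E[Y | A = a, U = u]`. -/
def outcomeMean (P : Population Ω 𝒰 𝒜 𝒵 𝒲 𝒞) (x : 𝒜 × 𝒰) : ℝ :=
  ∫ y, y ∂(condDistrib P.Y (fun ω => (P.A ω, P.U ω)) P.μ x)

/-- The value `v(π) = E_{U,C}[E[Y | A = π(C), U]]` of the policy `π`. -/
def value (P : Population Ω 𝒰 𝒜 𝒵 𝒲 𝒞) (π : 𝒞 → 𝒜) : ℝ :=
  ∫ ω, P.outcomeMean (π (P.C ω), P.U ω) ∂P.μ

/-- Overlap: the law of `(π(C), U)` is absolutely continuous with respect to the law of `(A, U)`,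
so that `E[Y | A = π(C), U]` does not depend on the version of `E[Y | A = a, U = u]`. -/
def Overlap (P : Population Ω 𝒰 𝒜 𝒵 𝒲 𝒞) (π : 𝒞 → 𝒜) : Prop :=
  P.μ.map (fun ω => (π (P.C ω), P.U ω)) ≪ P.μ.map (fun ω => (P.A ω, P.U ω))

/-- The law of `(π(C), W)` has a density `r_π` with respect to the law of `(A, W)`, and the
`L²`-norm of `r_π` with respect to the law of `(A, W)` is at most `ρ`. -/
def PolicyL2 (P : Population Ω 𝒰 𝒜 𝒵 𝒲 𝒞) (π : 𝒞 → 𝒜) (ρ : ℝ≥0) : Prop :=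
  P.μ.map (fun ω => (π (P.C ω), P.W ω)) ≪ P.μ.map (fun ω => (P.A ω, P.W ω)) ∧
    ∫⁻ x, ((P.μ.map (fun ω => (π (P.C ω), P.W ω))).rnDeriv
      (P.μ.map (fun ω => (P.A ω, P.W ω))) x) ^ 2 ∂(P.μ.map (fun ω => (P.A ω, P.W ω)))
      ≤ (ρ : ℝ≥0∞) ^ 2

end Population

/-- The Kronecker product of two vectors. -/
def kron {p q : ℕ} (x : Fin p → ℝ) (y : Fin q → ℝ) : Fin p × Fin q → ℝ :=
  fun ij => x ij.1 * y ij.2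

/-- The squared Euclidean norm. -/
def sqNorm {ι : Type*} [Fintype ι] (x : ι → ℝ) : ℝ := ∑ i, x i ^ 2

/-- The squared Frobenius norm. -/
def sqFrob {ι κ : Type*} [Fintype ι] [Fintype κ] (V : Matrix ι κ ℝ) : ℝ := ∑ i, ∑ j, V i j ^ 2

/-- Four parametrized feature maps (neural nets, continuous in their real weights and measurable in
their input), `φA, φZ` for stage 1 and `ψA, ψW` for stage 2, with the sets of parameters
`(V, θ_{A(1)}, θ_Z)`, `(u, θ_{A(2)})` and `θ_W` over which the losses are minimized. -/
structure FeatureModel (𝒜 𝒵 𝒲 : Type*) [MeasurableSpace 𝒜] [MeasurableSpace 𝒵]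
    [MeasurableSpace 𝒲] where
  (dφA dφZ dψA dψW : ℕ)
  (pφA pφZ pψA pψW : ℕ)
  φA : (Fin pφA → ℝ) → 𝒜 → Fin dφA → ℝ
  φZ : (Fin pφZ → ℝ) → 𝒵 → Fin dφZ → ℝ
  ψA : (Fin pψA → ℝ) → 𝒜 → Fin dψA → ℝ
  ψW : (Fin pψW → ℝ) → 𝒲 → Fin dψW → ℝ
  measurable_φA : ∀ θ, Measurable (φA θ)
  measurable_φZ : ∀ θ, Measurable (φZ θ)
  measurable_ψA : ∀ θ, Measurable (ψA θ)
  measurable_ψW : ∀ θ, Measurable (ψW θ)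
  continuous_φA : ∀ a, Continuous fun θ => φA θ a
  continuous_φZ : ∀ z, Continuous fun θ => φZ θ z
  continuous_ψA : ∀ a, Continuous fun θ => ψA θ a
  continuous_ψW : ∀ w, Continuous fun θ => ψW θ w
  stage1 : Set (Matrix (Fin dψW) (Fin dφA × Fin dφZ) ℝ × (Fin pφA → ℝ) × (Fin pφZ → ℝ))
  stage2 : Set ((Fin dψA × Fin dψW → ℝ) × (Fin pψA → ℝ))
  ΘW : Set (Fin pψW → ℝ)

namespace FeatureModel

variable {𝒜 𝒵 𝒲 : Type*} [MeasurableSpace 𝒜] [MeasurableSpace 𝒵] [MeasurableSpace 𝒲]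

/-- Stage 1 parameters `(V, θ_{A(1)}, θ_Z)`. -/
abbrev Par1 (F : FeatureModel 𝒜 𝒵 𝒲) : Type :=
  Matrix (Fin F.dψW) (Fin F.dφA × Fin F.dφZ) ℝ × (Fin F.pφA → ℝ) × (Fin F.pφZ → ℝ)

/-- Stage 2 parameters `(u, θ_{A(2)})`. -/
abbrev Par2 (F : FeatureModel 𝒜 𝒵 𝒲) : Type :=
  (Fin F.dψA × Fin F.dψW → ℝ) × (Fin F.pψA → ℝ)

/-- Weights `θ_W` of the features of `W`. -/
abbrev ParW (F : FeatureModel 𝒜 𝒵 𝒲) : Type := Fin F.pψW → ℝ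

/-- The stage 1 prediction `V (φ_{θ_{A(1)}}(a) ⊗ φ_{θ_Z}(z))`. -/
def pred1 (F : FeatureModel 𝒜 𝒵 𝒲) (p : F.Par1) (a : 𝒜) (z : 𝒵) : Fin F.dψW → ℝ :=
  p.1.mulVec (kron (F.φA p.2.1 a) (F.φZ p.2.2 z))

/-- The stage 2 prediction `uᵀ (ψ_{θ_{A(2)}}(a) ⊗ V (φ_{θ_{A(1)}}(a) ⊗ φ_{θ_Z}(z)))`. -/
def pred2 (F : FeatureModel 𝒜 𝒵 𝒲) (q : F.Par2) (p : F.Par1) (a : 𝒜) (z : 𝒵) : ℝ :=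
  q.1 ⬝ᵥ kron (F.ψA q.2 a) (F.pred1 p a z)

/-- The bridge function model `h(a, w) = uᵀ (ψ_{θ_{A(2)}}(a) ⊗ ψ_{θ_W}(w))`. -/
def bridge (F : FeatureModel 𝒜 𝒵 𝒲) (q : F.Par2) (θW : F.ParW) (x : 𝒜 × 𝒲) : ℝ :=
  q.1 ⬝ᵥ kron (F.ψA q.2 x.1) (F.ψW θW x.2)

/-- The stage 1 loss at one observation `(w, a, z)`. -/
def loss1 (F : FeatureModel 𝒜 𝒵 𝒲) (θW : F.ParW) (p : F.Par1) (x : 𝒲 × 𝒜 × 𝒵) : ℝ :=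
  sqNorm (F.ψW θW x.1 - F.pred1 p x.2.1 x.2.2)

/-- The stage 2 loss at one observation `(y, a, z)`. -/
def loss2 (F : FeatureModel 𝒜 𝒵 𝒲) (q : F.Par2) (p : F.Par1) (x : ℝ × 𝒜 × 𝒵) : ℝ :=
  (x.1 - F.pred2 q p x.2.1 x.2.2) ^ 2

/-- The class of stage 1 losses. -/
def H1 (F : FeatureModel 𝒜 𝒵 𝒲) : Set (𝒲 × 𝒜 × 𝒵 → ℝ) :=
  {f | ∃ θW ∈ F.ΘW, ∃ p ∈ F.stage1, f = F.loss1 θW p}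

/-- The class of stage 2 losses. -/
def H2 (F : FeatureModel 𝒜 𝒵 𝒲) : Set (ℝ × 𝒜 × 𝒵 → ℝ) :=
  {f | ∃ q ∈ F.stage2, ∃ p ∈ F.stage1, f = F.loss2 q p}

/-- Boundedness of the hypothesis spaces: the stage 1 predictions and the features of `W` have
Euclidean norm at most `1`, and `v ↦ uᵀ (ψ_{θ_{A(2)}}(a) ⊗ v)` has operator norm at most `M`. -/
def Bounded (F : FeatureModel 𝒜 𝒵 𝒲) (M : ℝ) : Prop :=
  (∀ p ∈ F.stage1, ∀ a z, sqNorm (F.pred1 p a z) ≤ 1) ∧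
    (∀ θW ∈ F.ΘW, ∀ w, sqNorm (F.ψW θW w) ≤ 1) ∧
    (∀ q ∈ F.stage2, ∀ a, sqNorm (fun j => ∑ i, q.1 (i, j) * F.ψA q.2 a i) ≤ M ^ 2)

/-- The empirical stage 1 loss with targets `ψ_{θ_W}(w_i)` and ridge parameter `lam`. -/
def empLoss1 (F : FeatureModel 𝒜 𝒵 𝒲) {m : ℕ} (S : Fin m → 𝒲 × 𝒜 × 𝒵) (lam : ℝ) (θW : F.ParW)
    (p : F.Par1) : ℝ :=
  (1 / (m : ℝ)) * ∑ i, F.loss1 θW p (S i) + lam * sqFrob p.1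

/-- The empirical stage 2 loss with ridge parameter `lam`. It depends on `θ_W` through the stage 1
solution `est θ_W`. -/
def empLoss2 (F : FeatureModel 𝒜 𝒵 𝒲) {n : ℕ} (S : Fin n → ℝ × 𝒜 × 𝒵) (lam : ℝ)
    (est : F.ParW → F.Par1) (r : F.Par2 × F.ParW) : ℝ :=
  (1 / (n : ℝ)) * ∑ i, F.loss2 r.1 (est r.2) (S i) + lam * sqNorm r.1.1

/-- `est θ_W` minimizes the empirical stage 1 loss for each `θ_W`. -/
def IsStage1Minimizer (F : FeatureModel 𝒜 𝒵 𝒲) {m : ℕ} (S : Fin m → 𝒲 × 𝒜 × 𝒵) (lam : ℝ)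
    (est : F.ParW → F.Par1) : Prop :=
  ∀ θW ∈ F.ΘW, est θW ∈ F.stage1 ∧ IsMinOn (F.empLoss1 S lam θW) F.stage1 (est θW)

/-- `r = (u, θ_{A(2)}, θ_W)` minimizes the empirical stage 2 loss. -/
def IsStage2Minimizer (F : FeatureModel 𝒜 𝒵 𝒲) {n : ℕ} (S : Fin n → ℝ × 𝒜 × 𝒵) (lam : ℝ)
    (est : F.ParW → F.Par1) (r : F.Par2 × F.ParW) : Prop :=
  r ∈ F.stage2 ×ˢ F.ΘW ∧ IsMinOn (F.empLoss2 S lam est) (F.stage2 ×ˢ F.ΘW) r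

/-- The estimate `v̂(π)`, the average of the learned bridge function over the sample `S`. -/
def estValue {𝒞 : Type*} (F : FeatureModel 𝒜 𝒵 𝒲) (π : 𝒞 → 𝒜) (r : F.Par2 × F.ParW) {n : ℕ}
    (S : Fin n → 𝒞 × 𝒲) : ℝ :=
  (1 / (n : ℝ)) * ∑ i, F.bridge r.1 r.2 (π (S i).1, (S i).2)

variable {Ω 𝒰 𝒞 : Type*} [MeasurableSpace Ω] [MeasurableSpace 𝒰] [MeasurableSpace 𝒞]

/-- Stage 1 misspecification: the largest, over `θ_W`, of the smallest mean squared distances from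
`E[ψ_{θ_W}(W) | A, Z]` to a stage 1 prediction. -/
def kappa1 (F : FeatureModel 𝒜 𝒵 𝒲) (P : Population Ω 𝒰 𝒜 𝒵 𝒲 𝒞) : ℝ :=
  ⨆ θW : F.ΘW, ⨅ p : F.stage1,
    ∫ ω, ∑ j, ((P.μ[fun ω' => F.ψW θW (P.W ω') j | P.sigmaAZ]) ω
      - F.pred1 p (P.A ω) (P.Z ω) j) ^ 2 ∂P.μ

/-- Stage 2 misspecification: the smallest `L²` distance from `E[Y | A, Z]` to `E[h(A, W) | A, Z]`,
over the bridge functions `h` in the model. -/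
def kappa2 (F : FeatureModel 𝒜 𝒵 𝒲) (P : Population Ω 𝒰 𝒜 𝒵 𝒲 𝒞) : ℝ :=
  ⨅ r : (F.stage2 ×ˢ F.ΘW : Set (F.Par2 × F.ParW)),
    Real.sqrt (∫ ω, ((P.μ[P.Y | P.sigmaAZ]) ω
      - (P.μ[fun ω' => F.bridge r.1.1 r.1.2 (P.A ω', P.W ω') | P.sigmaAZ]) ω) ^ 2 ∂P.μ)

/-- The measure of ill-posedness: the largest ratio of `‖h* - h‖` to `‖E[(h* - h)(A, W) | A, Z]‖`
(both in `L²`), over the bridge functions `h` in the model; here `0 / 0 = 0` and `x / 0 = ∞` for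
`x ≠ 0`. -/
def illPosedness (F : FeatureModel 𝒜 𝒵 𝒲) (P : Population Ω 𝒰 𝒜 𝒵 𝒲 𝒞) (hstar : 𝒜 × 𝒲 → ℝ) :
    ℝ≥0∞ :=
  ⨆ r ∈ F.stage2 ×ˢ F.ΘW,
    eLpNorm (fun ω => hstar (P.A ω, P.W ω) - F.bridge r.1 r.2 (P.A ω, P.W ω)) 2 P.μ /
      eLpNorm (P.μ[fun ω => hstar (P.A ω, P.W ω) - F.bridge r.1 r.2 (P.A ω, P.W ω) | P.sigmaAZ])
        2 P.μ

end FeatureModel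

/-- The empirical Rademacher complexity
`E_σ[sup_{f ∈ G} (1/n) ∑ i, σ_i f(S_i)]`, with `σ` uniform on `{-1, 1}ⁿ`. -/
def empRademacher {E : Type*} {n : ℕ} (G : Set (E → ℝ)) (S : Fin n → E) : ℝ :=
  (1 / (2 : ℝ) ^ n) * ∑ σ : Fin n → Bool,
    ⨆ f : G, (1 / (n : ℝ)) * ∑ i, (if σ i then (1 : ℝ) else -1) * (f : E → ℝ) (S i)

/-- `S` consists of independent observations with common law `ν`. -/
def IsIIDSample {Ω' E : Type*} [MeasurableSpace Ω'] [MeasurableSpace E] (Q : Measure Ω')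
    (ν : Measure E) {n : ℕ} (S : Fin n → Ω' → E) : Prop :=
  (∀ i, Measurable (S i)) ∧ iIndepFun S Q ∧ ∀ i, Q.map (S i) = ν

/-- The rate
`√(κ₁ + R̂_{S₁}(H₁) + 1/√m) + κ₂ + √(R̂_{S₂}(H₂) + 1/√n) + 1/√n'`. -/
def rate {Ω 𝒰 𝒜 𝒵 𝒲 𝒞 : Type*} [MeasurableSpace Ω] [MeasurableSpace 𝒰]
    [MeasurableSpace 𝒜] [MeasurableSpace 𝒵] [MeasurableSpace 𝒲] [MeasurableSpace 𝒞]
    (P : Population Ω 𝒰 𝒜 𝒵 𝒲 𝒞) (F : FeatureModel 𝒜 𝒵 𝒲) {m n : ℕ}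
    (S₁ : Fin m → 𝒲 × 𝒜 × 𝒵) (S₂ : Fin n → ℝ × 𝒜 × 𝒵) (n' : ℕ) : ℝ :=
  Real.sqrt (F.kappa1 P + empRademacher F.H1 S₁ + 1 / Real.sqrt m) + F.kappa2 P
    + Real.sqrt (empRademacher F.H2 S₂ + 1 / Real.sqrt n) + 1 / Real.sqrt n'

end

end DFPV

/-!
Completeness on the confounder identifies the value of a policy with the mean of the bridge function
`h*` under the law of `(π(C), W)`: `E[Y | A, U]` and `E[h*(A, W) | A, U]` have the same projection
on `(A, Z)`, so they agree almost surely, and overlap carries the equality over to `(π(C), U)`.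
Replacing `h*` by the learned bridge function then costs `ρ τ` times the `L²` distance between their
projections on `(A, Z)`. An excess risk argument bounds this distance: in both stages the population
risk is a squared distance to a conditional mean plus noise that no prediction can affect, and the
empirical risks are uniformly close to it by symmetrization. McDiarmid's exponential concentration
is not needed, because the constant may depend on `δ` arbitrarily; Chebyshev's inequality with the
Efron–Stein bound on the variance of a function with bounded differences suffices. The held-out
average is a mean of independent terms once the learned bridge function is fixed.
-/

namespace DFPV
theorem abs_integral_le {α : Type*} [MeasurableSpace α] {μ : Measure α} [IsProbabilityMeasure μ]
    {f : α → ℝ} {B : ℝ} (hB : ∀ x, |f x| ≤ B) : |∫ x, f x ∂μ| ≤ B := by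
  simpa using norm_integral_le_of_norm_le_const (μ := μ) (f := f) (.of_forall hB)

section BoundedDifferences

theorem variance_prod_eq {α β : Type*} [MeasurableSpace α] [MeasurableSpace β] {μ : Measure α}
    {ν : Measure β} [IsProbabilityMeasure μ] [IsProbabilityMeasure ν] {F : α × β → ℝ}
    (hF : MemLp F 2 (μ.prod ν)) :
    Var[F; μ.prod ν] =
      ∫ x, Var[fun y => F (x, y); ν] ∂μ + Var[fun x => ∫ y, F (x, y) ∂ν; μ] := by
  have hint : Integrable F (μ.prod ν) := hF.integrable one_le_two
  have hsq : Integrable (fun p => F p ^ 2) (μ.prod ν) := hF.integrable_sq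
  have hfib : ∀ᵐ x ∂μ, Var[fun y => F (x, y); ν]
      = ∫ y, F (x, y) ^ 2 ∂ν - (∫ y, F (x, y) ∂ν) ^ 2 := by
    filter_upwards [hF.1.prodMk_left, hsq.prod_right_ae] with x hx hx2
    exact variance_eq_sub ((memLp_two_iff_integrable_sq hx).2 hx2)
  have hmean : MemLp (fun x => ∫ y, F (x, y) ∂ν) 2 μ := by
    refine (memLp_two_iff_integrable_sq hint.integral_prod_left.1).2
      (hsq.integral_prod_left.mono' (hint.integral_prod_left.1.pow 2) ?_)
    filter_upwards [hfib] with x hx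
    rw [Real.norm_of_nonneg (sq_nonneg _)]
    linarith [variance_nonneg (fun y => F (x, y)) ν]
  rw [integral_congr_ae hfib, integral_sub hsq.integral_prod_left hmean.integrable_sq,
    variance_eq_sub hF, variance_eq_sub hmean, integral_prod _ hint]
  simp only [Pi.pow_apply]
  rw [integral_prod _ hsq]
  ring

theorem variance_le_sq_of_abs_sub_le {α : Type*} [MeasurableSpace α] {μ : Measure α}
    [IsProbabilityMeasure μ] {X : α → ℝ} (hX : AEMeasurable X μ) {c : ℝ}
    (hc : ∀ x x', |X x - X x'| ≤ c) : Var[X; μ] ≤ c ^ 2 := by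
  obtain ⟨x₀⟩ := μ.nonempty_of_neZero
  refine (variance_le_sq_of_bounded (a := X x₀ - c) (b := X x₀ + c)
    (Filter.Eventually.of_forall fun x => ?_) hX).trans_eq (by ring)
  exact ⟨by linarith [(abs_le.1 (hc x x₀)).1], by linarith [(abs_le.1 (hc x x₀)).2]⟩

theorem measure_sqrt_div_lt_abs_sub_integral_le {α : Type*} [MeasurableSpace α] {μ : Measure α}
    [IsFiniteMeasure μ] {X : α → ℝ} (hX : MemLp X 2 μ) {v η : ℝ} (hv : Var[X; μ] ≤ v)
    (hv₀ : 0 < v) (hη : 0 < η) : μ {x | √(v / η) < |X x - μ[X]|} ≤ ENNReal.ofReal η := by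
  have ht : 0 < √(v / η) := by positivity
  calc μ {x | √(v / η) < |X x - μ[X]|}
      ≤ μ {x | √(v / η) ≤ |X x - μ[X]|} := measure_mono fun x hx => (show √(v / η) < _ from hx).le
    _ ≤ ENNReal.ofReal (Var[X; μ] / √(v / η) ^ 2) := meas_ge_le_variance_div_sq hX ht
    _ ≤ ENNReal.ofReal η := by
        refine ENNReal.ofReal_le_ofReal ?_
        rw [Real.sq_sqrt (by positivity), div_le_iff₀ (by positivity)]
        exact hv.trans_eq (by field_simp)

/-- Bounded differences: changing the `i`-th coordinate of the argument changes `F` by at most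
`c i`. -/
def BoundedDiff {n : ℕ} {E : Fin n → Type*} (F : (∀ i, E i) → ℝ) (c : Fin n → ℝ) : Prop :=
  ∀ S i x, |F (Function.update S i x) - F S| ≤ c i

theorem measurable_cons {n : ℕ} {E : Fin (n + 1) → Type*} [∀ i, MeasurableSpace (E i)] :
    Measurable fun p : E 0 × (∀ i : Fin n, E i.succ) => (Fin.cons p.1 p.2 : ∀ i, E i) :=
  measurable_pi_iff.2 <|
    Fin.cases measurable_fst fun j => (measurable_pi_apply j).comp measurable_snd

theorem measurePreserving_head_tail {n : ℕ} {E : Fin (n + 1) → Type*}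
    [∀ i, MeasurableSpace (E i)] (ν : ∀ i, Measure (E i)) [∀ i, IsProbabilityMeasure (ν i)] :
    MeasurePreserving (fun S => (S 0, Fin.tail S)) (Measure.pi ν)
      ((ν 0).prod (Measure.pi fun i : Fin n => ν i.succ)) :=
  measurePreserving_piFinSuccAbove ν 0

namespace BoundedDiff

theorem cons {n : ℕ} {E : Fin (n + 1) → Type*} {F : (∀ i, E i) → ℝ} {c : Fin (n + 1) → ℝ}
    (hc : BoundedDiff F c) (x : E 0) :
    BoundedDiff (fun S : ∀ i : Fin n, E i.succ => F (Fin.cons x S)) fun i => c i.succ := by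
  intro S i y
  simpa only [Fin.cons_update] using hc (Fin.cons x S) i.succ y

theorem abs_cons_sub_cons_le {n : ℕ} {E : Fin (n + 1) → Type*} {F : (∀ i, E i) → ℝ}
    {c : Fin (n + 1) → ℝ} (hc : BoundedDiff F c) (x y : E 0) (S : ∀ i : Fin n, E i.succ) :
    |F (Fin.cons x S) - F (Fin.cons y S)| ≤ c 0 := by
  simpa only [Fin.update_cons_zero] using hc (Fin.cons y S) 0 x

theorem abs_sub_le_sum {n : ℕ} {E : Fin n → Type*} {F : (∀ i, E i) → ℝ} {c : Fin n → ℝ}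
    (hc : BoundedDiff F c) (S T : ∀ i, E i) : |F S - F T| ≤ ∑ i, c i := by
  induction n with
  | zero => simp [Subsingleton.elim S T]
  | succ n ih =>
    have h₀ := hc.abs_cons_sub_cons_le (S 0) (T 0) (Fin.tail S)
    have htail := ih (hc.cons (T 0)) (Fin.tail S) (Fin.tail T)
    simp only [Fin.cons_self_tail] at h₀ htail
    rw [Fin.sum_univ_succ]
    exact (abs_sub_le _ (F (Fin.cons (T 0) (Fin.tail S))) _).trans (add_le_add h₀ htail)

variable {n : ℕ} {E : Fin n → Type*} [∀ i, MeasurableSpace (E i)] {F : (∀ i, E i) → ℝ}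
  {c : Fin n → ℝ}

theorem memLp (hc : BoundedDiff F c) (hF : Measurable F) (p : ℝ≥0∞) (μ : Measure (∀ i, E i))
    [IsFiniteMeasure μ] : MemLp F p μ := by
  rcases isEmpty_or_nonempty (∀ i, E i) with _ | ⟨⟨S₀⟩⟩
  · simp [μ.eq_zero_of_isEmpty]
  · refine MemLp.of_bound hF.aestronglyMeasurable (|F S₀| + ∑ i, c i)
      (Filter.Eventually.of_forall fun S => ?_)
    rw [Real.norm_eq_abs]
    linarith [hc.abs_sub_le_sum S S₀, abs_sub_abs_le_abs_sub (F S) (F S₀)]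

theorem variance_le (hc : BoundedDiff F c) (hF : Measurable F) (ν : ∀ i, Measure (E i))
    [∀ i, IsProbabilityMeasure (ν i)] : Var[F; Measure.pi ν] ≤ ∑ i, c i ^ 2 := by
  induction n with
  | zero =>
    simpa using variance_le_sq_of_abs_sub_le (μ := Measure.pi ν) hF.aemeasurable (c := 0)
      fun S T => by simp [Subsingleton.elim S T]
  | succ n ih =>
    set τ : Measure (∀ i : Fin n, E i.succ) := Measure.pi fun i => ν i.succ
    have hFc : Measurable fun p : E 0 × (∀ i : Fin n, E i.succ) => F (Fin.cons p.1 p.2) :=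
      hF.comp measurable_cons
    have hfib : ∀ x, Measurable fun S => F (Fin.cons x S) := fun x =>
      hFc.comp measurable_prodMk_left
    have htail : ∀ x, Var[fun S => F (Fin.cons x S); τ] ≤ ∑ i : Fin n, c i.succ ^ 2 := fun x =>
      ih (hc.cons x) (hfib x) _
    have hint : ∀ x, Integrable (fun S => F (Fin.cons x S)) τ := fun x =>
      memLp_one_iff_integrable.1 ((hc.cons x).memLp (hfib x) 1 τ)
    have hhead : Var[fun x => ∫ S, F (Fin.cons x S) ∂τ; ν 0] ≤ c 0 ^ 2 := by
      refine variance_le_sq_of_abs_sub_le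
        hFc.stronglyMeasurable.integral_prod_right'.measurable.aemeasurable fun x y => ?_
      rw [← integral_sub (hint x) (hint y)]
      exact abs_integral_le fun S => hc.abs_cons_sub_cons_le x y S
    have mp := measurePreserving_head_tail ν
    have hsplit : F = (fun p => F (Fin.cons p.1 p.2)) ∘ fun S => (S 0, Fin.tail S) := by
      funext S
      simp
    have hprod : MemLp (fun p => F (Fin.cons p.1 p.2)) 2 ((ν 0).prod τ) := by
      rw [← mp.map_eq, memLp_map_measure_iff hFc.aestronglyMeasurable mp.measurable.aemeasurable,
        ← hsplit]
      exact hc.memLp hF 2 _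
    rw [hsplit, Function.comp_def, mp.variance_fun_comp hFc.aemeasurable, variance_prod_eq hprod,
      Fin.sum_univ_succ, add_comm]
    gcongr
    exact (integral_mono_of_nonneg (.of_forall fun x => variance_nonneg _ _) (integrable_const _)
      (.of_forall htail)).trans_eq (by simp)

end BoundedDiff
end BoundedDifferences

section Rademacher

variable {E ι : Type*} {n : ℕ}

/-- The arithmetic mean of finitely many reals; it is `0` when there are none. -/
noncomputable def avg (a : Fin n → ℝ) : ℝ := (1 / (n : ℝ)) * ∑ j, a j

theorem avg_add (a b : Fin n → ℝ) : avg (fun j => a j + b j) = avg a + avg b := by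
  simp only [avg, Finset.sum_add_distrib, mul_add]

theorem avg_sub (a b : Fin n → ℝ) : avg (fun j => a j - b j) = avg a - avg b := by
  simp only [avg, Finset.sum_sub_distrib, mul_sub]

theorem avg_neg (a : Fin n → ℝ) : avg (fun j => -a j) = -avg a := by
  simp only [avg, Finset.sum_neg_distrib, mul_neg]

theorem avg_const [NeZero n] (c : ℝ) : avg (fun _ : Fin n => c) = c := by
  have : (n : ℝ) ≠ 0 := NeZero.ne _
  simp [avg, this]

theorem abs_avg_le [NeZero n] {a : Fin n → ℝ} {B : ℝ} (h : ∀ j, |a j| ≤ B) : |avg a| ≤ B := by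
  rw [avg, abs_mul, abs_of_nonneg (by positivity)]
  calc 1 / (n : ℝ) * |∑ j, a j| ≤ 1 / (n : ℝ) * ∑ _j : Fin n, B := by
        gcongr
        exact (Finset.abs_sum_le_sum_abs _ _).trans (Finset.sum_le_sum fun j _ => h j)
    _ = B := avg_const B

theorem measurable_avg {α : Type*} [MeasurableSpace α] {g : Fin n → α → ℝ}
    (hg : ∀ j, Measurable (g j)) : Measurable fun x => avg fun j => g j x :=
  (Finset.measurable_fun_sum _ fun j _ => hg j).const_mul _

theorem integral_avg {α : Type*} [MeasurableSpace α] {μ : Measure α} {g : Fin n → α → ℝ}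
    (hg : ∀ j, Integrable (g j) μ) : ∫ x, avg (fun j => g j x) ∂μ = avg fun j => ∫ x, g j x ∂μ := by
  simp only [avg]
  rw [integral_const_mul, integral_finsetSum _ fun j _ => hg j]

theorem bddAbove_range_of_abs_le {a : ι → ℝ} {B : ℝ} (h : ∀ i, |a i| ≤ B) :
    BddAbove (Set.range a) :=
  ⟨B, Set.forall_mem_range.2 fun i => (abs_le.1 (h i)).2⟩

theorem abs_iSup_le [Nonempty ι] {a : ι → ℝ} {B : ℝ} (h : ∀ i, |a i| ≤ B) : |⨆ i, a i| ≤ B := by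
  obtain ⟨i⟩ := ‹Nonempty ι›
  exact abs_le.2 ⟨(abs_le.1 (h i)).1.trans (le_ciSup (bddAbove_range_of_abs_le h) i),
    ciSup_le fun i => (abs_le.1 (h i)).2⟩

theorem abs_iSup_sub_iSup_le [Nonempty ι] {a b : ι → ℝ} {c : ℝ} (ha : BddAbove (Set.range a))
    (hb : BddAbove (Set.range b)) (h : ∀ i, |a i - b i| ≤ c) : |(⨆ i, a i) - ⨆ i, b i| ≤ c := by
  refine abs_sub_le_iff.2 ⟨sub_le_iff_le_add.2 (ciSup_le fun i => ?_),
    sub_le_iff_le_add.2 (ciSup_le fun i => ?_)⟩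
  · linarith [(abs_sub_le_iff.1 (h i)).1, le_ciSup hb i]
  · linarith [(abs_sub_le_iff.1 (h i)).2, le_ciSup ha i]

/-- The mean of `a` with the sign of `a j` changed where `σ j` is `false`. -/
noncomputable def signedAvg (σ : Fin n → Bool) (a : Fin n → ℝ) : ℝ :=
  avg fun j => (if σ j then (1 : ℝ) else -1) * a j

theorem signedAvg_true (a : Fin n → ℝ) : signedAvg (fun _ => true) a = avg a := by
  simp [signedAvg]

theorem signedAvg_not (σ : Fin n → Bool) (a : Fin n → ℝ) :
    signedAvg (fun j => !σ j) a = signedAvg σ fun j => -a j := by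
  unfold signedAvg
  congr 1
  funext j
  cases h : σ j <;> simp [h]

theorem signedAvg_neg (σ : Fin n → Bool) (a : Fin n → ℝ) :
    signedAvg σ (fun j => -a j) = -signedAvg σ a := by
  simp only [signedAvg, mul_neg, avg_neg]

theorem signedAvg_add (σ : Fin n → Bool) (a b : Fin n → ℝ) :
    signedAvg σ (fun j => a j + b j) = signedAvg σ a + signedAvg σ b := by
  simp only [signedAvg, mul_add, avg_add]

theorem signedAvg_sub (σ : Fin n → Bool) (a b : Fin n → ℝ) :
    signedAvg σ (fun j => a j - b j) = signedAvg σ a - signedAvg σ b := by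
  simp only [signedAvg, mul_sub, avg_sub]

theorem abs_signedAvg_le [NeZero n] (σ : Fin n → Bool) {a : Fin n → ℝ} {B : ℝ}
    (h : ∀ j, |a j| ≤ B) : |signedAvg σ a| ≤ B :=
  abs_avg_le fun j => by cases σ j <;> simpa using h j

theorem abs_signedAvg_update_sub_le (σ : Fin n → Bool) {g : E → ℝ} {D : ℝ}
    (hD : ∀ x y, |g x - g y| ≤ D) (S : Fin n → E) (k : Fin n) (x : E) :
    |signedAvg σ (fun j => g (Function.update S k x j)) - signedAvg σ (fun j => g (S j))|
      ≤ D / n := by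
  rw [← signedAvg_sub, signedAvg, avg, Finset.sum_eq_single k, Function.update_self, abs_mul,
    abs_of_nonneg (by positivity), div_eq_mul_one_div D, mul_comm D]
  · gcongr
    cases σ k
    · simpa using hD (S k) x
    · simpa using hD x (S k)
  · intro j _ hj
    rw [Function.update_of_ne hj, sub_self, mul_zero]
  · simp

/-- The supremum over the family `f` of the signed means of the values on the sample `S`; the
empirical Rademacher complexity is its mean over the signs `σ`. -/
noncomputable def signedSup (f : ι → E → ℝ) (σ : Fin n → Bool) (S : Fin n → E) : ℝ :=
  ⨆ i, signedAvg σ fun j => f i (S j)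

theorem empRademacher_range (f : ι → E → ℝ) (S : Fin n → E) :
    empRademacher (Set.range f) S = (1 / (2 : ℝ) ^ n) * ∑ σ, signedSup f σ S := by
  unfold empRademacher
  congr 1
  exact Finset.sum_congr rfl fun σ _ =>
    iSup_range' (fun g : E → ℝ => signedAvg σ fun j => g (S j)) f

theorem sum_signs_not (a : (Fin n → Bool) → ℝ) :
    ∑ σ : Fin n → Bool, a (fun j => !σ j) = ∑ σ, a σ :=
  Fintype.sum_equiv (Equiv.piCongrRight fun _ : Fin n => Equiv.boolNot) _ _ fun _ => rfl

theorem abs_sign_average_le {a : (Fin n → Bool) → ℝ} {c : ℝ} (h : ∀ σ, |a σ| ≤ c) :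
    |(1 / (2 : ℝ) ^ n) * ∑ σ, a σ| ≤ c := by
  rw [abs_mul, abs_of_pos (by positivity)]
  calc 1 / (2 : ℝ) ^ n * |∑ σ, a σ| ≤ 1 / (2 : ℝ) ^ n * ∑ _σ : Fin n → Bool, c := by
        gcongr
        exact (Finset.abs_sum_le_sum_abs _ _).trans (Finset.sum_le_sum fun j _ => h j)
    _ = c := by simp

theorem empRademacher_range_neg (f : ι → E → ℝ) (S : Fin n → E) :
    empRademacher (Set.range fun i x => -f i x) S = empRademacher (Set.range f) S := by
  rw [empRademacher_range, empRademacher_range, ← sum_signs_not fun σ => signedSup f σ S]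
  simp only [signedSup, signedAvg_not]

theorem empRademacher_singleton (g : E → ℝ) (S : Fin n → E) : empRademacher {g} S = 0 := by
  have hneg := sum_signs_not fun σ : Fin n → Bool => signedAvg σ fun j => g (S j)
  simp only [signedAvg_not, signedAvg_neg, Finset.sum_neg_distrib] at hneg
  rw [← Set.range_const (ι := Unit), empRademacher_range]
  simp only [signedSup, ciSup_const]
  rw [self_eq_neg.1 hneg.symm, mul_zero]

section Bounded

variable [NeZero n] {f : ι → E → ℝ} {B : ℝ}

theorem signedAvg_le_signedSup {S : Fin n → E} (hB : ∀ i j, |f i (S j)| ≤ B) (σ : Fin n → Bool)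
    (i : ι) : signedAvg σ (fun j => f i (S j)) ≤ signedSup f σ S :=
  le_ciSup (bddAbove_range_of_abs_le fun i => abs_signedAvg_le σ (hB i)) i

theorem empRademacher_range_comp_le {κ : Type*} [Nonempty κ] {S : Fin n → E}
    (hB : ∀ i j, |f i (S j)| ≤ B) (d : κ → ι) :
    empRademacher (Set.range fun k => f (d k)) S ≤ empRademacher (Set.range f) S := by
  rw [empRademacher_range, empRademacher_range]
  gcongr with σ
  exact ciSup_le fun k => signedAvg_le_signedSup hB σ (d k)

theorem empRademacher_nonneg {G : Set (E → ℝ)} {S : Fin n → E}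
    (hB : ∀ g ∈ G, ∀ j, |g (S j)| ≤ B) : 0 ≤ empRademacher G S := by
  rcases G.eq_empty_or_nonempty with rfl | ⟨g, hg⟩
  · simp [empRademacher]
  · have h := empRademacher_range_comp_le (f := fun g : G => (g : E → ℝ)) (S := S)
      (fun g j => hB g g.2 j) fun _ : Unit => ⟨g, hg⟩
    rwa [Set.range_const, empRademacher_singleton, Subtype.range_coe] at h

variable [Nonempty ι]

theorem abs_signedSup_le (hB : ∀ i x, |f i x| ≤ B) (σ : Fin n → Bool) (S : Fin n → E) :
    |signedSup f σ S| ≤ B :=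
  abs_iSup_le fun i => abs_signedAvg_le σ fun j => hB i (S j)

theorem boundedDiff_signedSup {D : ℝ} (hB : ∀ i x, |f i x| ≤ B)
    (hD : ∀ i x y, |f i x - f i y| ≤ D) (σ : Fin n → Bool) :
    BoundedDiff (signedSup f σ) fun _ => D / n := fun S k x =>
  abs_iSup_sub_iSup_le
    (bddAbove_range_of_abs_le fun i => abs_signedAvg_le σ fun j => hB i (Function.update S k x j))
    (bddAbove_range_of_abs_le fun i => abs_signedAvg_le σ fun j => hB i (S j))
    fun i => abs_signedAvg_update_sub_le σ (hD i) S k x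

theorem boundedDiff_empRademacher {D : ℝ} (hB : ∀ i x, |f i x| ≤ B)
    (hD : ∀ i x y, |f i x - f i y| ≤ D) :
    BoundedDiff (empRademacher (n := n) (Set.range f)) fun _ => D / n := fun S k x => by
  rw [empRademacher_range, empRademacher_range, ← mul_sub, ← Finset.sum_sub_distrib]
  exact abs_sign_average_le fun σ => boundedDiff_signedSup hB hD σ S k x

end Bounded

variable [MeasurableSpace E] [Countable ι] {f : ι → E → ℝ}

theorem measurable_signedSup (hf : ∀ i, Measurable (f i)) (σ : Fin n → Bool) :
    Measurable (signedSup f σ) :=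
  Measurable.iSup fun i => measurable_avg fun j =>
    ((hf i).comp (measurable_pi_apply j)).const_mul _

theorem measurable_empRademacher (hf : ∀ i, Measurable (f i)) :
    Measurable (empRademacher (n := n) (Set.range f)) := by
  rw [funext (empRademacher_range f)]
  exact (Finset.measurable_fun_sum _ fun σ _ => measurable_signedSup hf σ).const_mul _

theorem integrable_signedSup [NeZero n] [Nonempty ι] {B : ℝ} (hf : ∀ i, Measurable (f i))
    (hB : ∀ i x, |f i x| ≤ B) (σ : Fin n → Bool) {α : Type*} [MeasurableSpace α] {μ : Measure α}
    [IsFiniteMeasure μ] {S : α → Fin n → E} (hS : Measurable S) :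
    Integrable (fun x => signedSup f σ (S x)) μ :=
  .of_bound ((measurable_signedSup hf σ).comp hS).aestronglyMeasurable B
    (.of_forall fun x => abs_signedSup_le hB σ (S x))

end Rademacher

section Symmetrization

variable {E ι : Type*} {f : ι → E → ℝ} {B : ℝ} {n : ℕ}

/-- The differences of a family of functions, as functions of a pair of observations. -/
def pairDiff (f : ι → E → ℝ) (i : ι) (p : E × E) : ℝ := f i p.2 - f i p.1

theorem abs_sub_le_two_mul (hB : ∀ i x, |f i x| ≤ B) (i : ι) (x y : E) :
    |f i x - f i y| ≤ 2 * B := by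
  linarith [abs_sub (f i x) (f i y), hB i x, hB i y]

theorem abs_pairDiff_le (hB : ∀ i x, |f i x| ≤ B) (i : ι) (p : E × E) :
    |pairDiff f i p| ≤ 2 * B :=
  abs_sub_le_two_mul hB i p.2 p.1

theorem signedSup_pairDiff_le [NeZero n] [Nonempty ι] (hB : ∀ i x, |f i x| ≤ B)
    (σ : Fin n → Bool) (p : Fin n → E × E) :
    signedSup (pairDiff f) σ p ≤
      signedSup f σ (fun j => (p j).2) + signedSup f (fun j => !σ j) fun j => (p j).1 := by
  refine ciSup_le fun i => ?_
  calc signedAvg σ (fun j => pairDiff f i (p j))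
      = signedAvg σ (fun j => f i (p j).2) + signedAvg (fun j => !σ j) fun j => f i (p j).1 := by
        rw [signedAvg_not, ← signedAvg_add]
        simp only [pairDiff, sub_eq_add_neg]
    _ ≤ _ := add_le_add (signedAvg_le_signedSup (fun i j => hB i (p j).2) σ i)
        (signedAvg_le_signedSup (fun i j => hB i (p j).1) _ i)

variable [MeasurableSpace E]

theorem measurable_pairDiff (hf : ∀ i, Measurable (f i)) (i : ι) : Measurable (pairDiff f i) :=
  ((hf i).comp measurable_snd).sub ((hf i).comp measurable_fst)

/-- The deviations of a family of functions from their means. -/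
noncomputable def centered (ν : Measure E) (f : ι → E → ℝ) (i : ι) (x : E) : ℝ :=
  ∫ y, f i y ∂ν - f i x

theorem avg_centered [NeZero n] (ν : Measure E) (f : ι → E → ℝ) (i : ι) (S : Fin n → E) :
    avg (fun j => centered ν f i (S j)) = ∫ x, f i x ∂ν - avg fun j => f i (S j) := by
  simp only [centered, avg_sub, avg_const]

theorem integral_comp_of_measurePreserving {α β : Type*} [MeasurableSpace α] [MeasurableSpace β]
    {μ : Measure α} {ν : Measure β} {φ : α → β} (hφ : MeasurePreserving φ μ ν) {g : β → ℝ}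
    (hg : Measurable g) : ∫ x, g (φ x) ∂μ = ∫ y, g y ∂ν := by
  rw [← hφ.map_eq, integral_map hφ.measurable.aemeasurable hg.aestronglyMeasurable]

variable (ν : Measure E) [IsProbabilityMeasure ν]

theorem abs_centered_le (hB : ∀ i x, |f i x| ≤ B) (i : ι) (x : E) :
    |centered ν f i x| ≤ 2 * B := by
  unfold centered
  linarith [abs_sub (∫ y, f i y ∂ν) (f i x), abs_integral_le (μ := ν) (hB i), hB i x]

theorem measurePreserving_swap_where (σ : Fin n → Bool) :
    MeasurePreserving (fun (p : Fin n → E × E) j => if σ j then p j else (p j).swap)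
      (Measure.pi fun _ => ν.prod ν) (Measure.pi fun _ => ν.prod ν) := by
  refine measurePreserving_pi (fun _ => ν.prod ν) (fun _ => ν.prod ν)
    (f := fun j q => if σ j then q else q.swap) fun j => ?_
  cases σ j
  · simpa using Measure.measurePreserving_swap
  · exact .id (ν.prod ν)

theorem integral_signedSup_pairDiff_eq [Countable ι] (hf : ∀ i, Measurable (f i))
    (σ : Fin n → Bool) :
    ∫ p, signedSup (pairDiff f) σ p ∂(Measure.pi fun _ : Fin n => ν.prod ν) =
      ∫ p, signedSup (pairDiff f) (fun _ => true) p ∂(Measure.pi fun _ : Fin n => ν.prod ν) := by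
  rw [← integral_comp_of_measurePreserving (measurePreserving_swap_where ν σ)
    (measurable_signedSup (measurable_pairDiff hf) _)]
  refine integral_congr_ae (.of_forall fun p => iSup_congr fun i => ?_)
  rw [signedAvg_true]
  refine congrArg avg (funext fun j => ?_)
  cases h : σ j <;> simp [pairDiff, h]

variable [NeZero n] [Countable ι] [Nonempty ι]

theorem signedSup_centered_le_integral (hf : ∀ i, Measurable (f i)) (hB : ∀ i x, |f i x| ≤ B)
    (S : Fin n → E) :
    signedSup (centered ν f) (fun _ => true) S ≤
      ∫ S', signedSup (pairDiff f) (fun _ => true) (fun j => (S j, S' j))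
        ∂(Measure.pi fun _ : Fin n => ν) := by
  have hint : ∀ i j, Integrable (fun S' : Fin n → E => f i (S' j)) (Measure.pi fun _ => ν) :=
    fun i j => .of_bound ((hf i).comp (measurable_pi_apply j)).aestronglyMeasurable B
      (.of_forall fun S' => hB i (S' j))
  have hdiff : ∀ i j, Integrable (fun S' : Fin n → E => pairDiff f i (S j, S' j))
      (Measure.pi fun _ => ν) := fun i j => (hint i j).sub (integrable_const (f i (S j)))
  have hmean : ∀ i j, centered ν f i (S j)
      = ∫ S', pairDiff f i (S j, S' j) ∂(Measure.pi fun _ : Fin n => ν) := fun i j => by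
    simp only [pairDiff, centered]
    rw [integral_sub (hint i j) (integrable_const _), integral_const, probReal_univ, one_smul,
      ← integral_comp_of_measurePreserving (measurePreserving_eval (fun _ : Fin n => ν) j) (hf i)]
  refine ciSup_le fun i => ?_
  rw [signedAvg_true, funext (hmean i), ← integral_avg (hdiff i)]
  refine integral_mono (.const_mul (integrable_finsetSum _ fun j _ => hdiff i j) _)
    (integrable_signedSup (measurable_pairDiff hf) (abs_pairDiff_le hB) _ (by fun_prop))
    fun S' => ?_
  simp only [← signedAvg_true]
  exact signedAvg_le_signedSup (fun i j => abs_pairDiff_le hB i (S j, S' j)) (fun _ => true) i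

theorem integral_signedSup_centered_le (hf : ∀ i, Measurable (f i)) (hB : ∀ i x, |f i x| ≤ B) :
    ∫ S, signedSup (centered ν f) (fun _ => true) S ∂(Measure.pi fun _ : Fin n => ν) ≤
      ∫ p, signedSup (pairDiff f) (fun _ => true) p ∂(Measure.pi fun _ : Fin n => ν.prod ν) := by
  have hint := integrable_signedSup (n := n) (measurable_pairDiff hf) (abs_pairDiff_le hB)
    (fun _ => true) (μ := (Measure.pi fun _ => ν).prod (Measure.pi fun _ => ν))
    (S := fun q : (Fin n → E) × (Fin n → E) => fun j => (q.1 j, q.2 j)) (by fun_prop)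
  have mp := measurePreserving_arrowProdEquivProdArrow E E (Fin n) (fun _ => ν) (fun _ => ν)
  refine (integral_mono (integrable_signedSup (fun i => (hf i).const_sub _)
    (abs_centered_le ν hB) _ measurable_id) hint.integral_prod_left
    (signedSup_centered_le_integral ν hf hB)).trans_eq ?_
  rw [← integral_prod _ hint, ← mp.integral_comp']
  rfl

theorem integral_signedSup_pairDiff_le (hf : ∀ i, Measurable (f i)) (hB : ∀ i x, |f i x| ≤ B)
    (σ : Fin n → Bool) :
    ∫ p, signedSup (pairDiff f) σ p ∂(Measure.pi fun _ : Fin n => ν.prod ν) ≤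
      ∫ S, signedSup f σ S ∂(Measure.pi fun _ => ν) +
        ∫ S, signedSup f (fun j => !σ j) S ∂(Measure.pi fun _ => ν) := by
  have mp₁ : MeasurePreserving (fun (p : Fin n → E × E) j => (p j).1)
      (Measure.pi fun _ => ν.prod ν) (Measure.pi fun _ => ν) :=
    measurePreserving_pi _ _ fun _ => measurePreserving_fst
  have mp₂ : MeasurePreserving (fun (p : Fin n → E × E) j => (p j).2)
      (Measure.pi fun _ => ν.prod ν) (Measure.pi fun _ => ν) :=
    measurePreserving_pi _ _ fun _ => measurePreserving_snd
  have hint₁ := integrable_signedSup hf hB (fun j => !σ j) (μ := Measure.pi fun _ => ν.prod ν)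
    mp₁.measurable
  have hint₂ := integrable_signedSup hf hB σ (μ := Measure.pi fun _ => ν.prod ν) mp₂.measurable
  rw [← integral_comp_of_measurePreserving mp₁ (measurable_signedSup hf fun j => !σ j),
    ← integral_comp_of_measurePreserving mp₂ (measurable_signedSup hf σ),
    ← integral_add hint₂ hint₁]
  exact integral_mono (integrable_signedSup (measurable_pairDiff hf) (abs_pairDiff_le hB) σ
    measurable_id) (hint₂.add hint₁) (signedSup_pairDiff_le hB σ)

theorem integral_empRademacher_range (hf : ∀ i, Measurable (f i)) (hB : ∀ i x, |f i x| ≤ B) :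
    ∫ S, empRademacher (Set.range f) S ∂(Measure.pi fun _ : Fin n => ν) =
      (1 / (2 : ℝ) ^ n) * ∑ σ, ∫ S, signedSup f σ S ∂(Measure.pi fun _ : Fin n => ν) := by
  have hint : ∀ σ, Integrable (fun S => signedSup f σ S) (Measure.pi fun _ : Fin n => ν) :=
    fun σ => integrable_signedSup hf hB σ measurable_id
  simp only [empRademacher_range]
  rw [integral_const_mul, integral_finsetSum _ fun σ _ => hint σ]

theorem integral_signedSup_centered_le_two_mul (hf : ∀ i, Measurable (f i))
    (hB : ∀ i x, |f i x| ≤ B) :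
    ∫ S, signedSup (centered ν f) (fun _ => true) S ∂(Measure.pi fun _ : Fin n => ν) ≤
      2 * ∫ S, empRademacher (Set.range f) S ∂(Measure.pi fun _ : Fin n => ν) := by
  set D := ∫ S, signedSup (centered ν f) (fun _ => true) S ∂(Measure.pi fun _ : Fin n => ν)
  set I : (Fin n → Bool) → ℝ := fun σ => ∫ S, signedSup f σ S ∂(Measure.pi fun _ : Fin n => ν)
  have hσ : ∀ σ : Fin n → Bool, D ≤ I σ + I fun j => !σ j := fun σ =>
    (integral_signedSup_centered_le ν hf hB).trans
      ((integral_signedSup_pairDiff_eq ν hf σ).ge.trans (integral_signedSup_pairDiff_le ν hf hB σ))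
  calc D = (1 / (2 : ℝ) ^ n) * ∑ _σ : Fin n → Bool, D := by simp
    _ ≤ (1 / (2 : ℝ) ^ n) * ∑ σ : Fin n → Bool, (I σ + I fun j => !σ j) := by
        gcongr with σ
        exact hσ σ
    _ = 2 * ∫ S, empRademacher (Set.range f) S ∂(Measure.pi fun _ : Fin n => ν) := by
        rw [integral_empRademacher_range ν hf hB, Finset.sum_add_distrib, sum_signs_not I]
        ring

end Symmetrization

section UniformDeviation

variable {E T : Type*} [MeasurableSpace E] {n : ℕ} [NeZero n]

theorem measure_lt_abs_sub_integral_le_of_boundedDiff {E : Fin n → Type*}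
    [∀ j, MeasurableSpace (E j)] (ν : ∀ j, Measure (E j)) [∀ j, IsProbabilityMeasure (ν j)]
    {F : (∀ j, E j) → ℝ} {c η : ℝ} (hF : Measurable F) (hc : BoundedDiff F fun _ => c / n)
    (hc₀ : 0 < c) (hη : 0 < η) :
    Measure.pi ν {S | c / √η * (1 / √n) < |F S - ∫ S', F S' ∂(Measure.pi ν)|} ≤
      ENNReal.ofReal η := by
  have hn : (0 : ℝ) < n := Nat.cast_pos.2 (NeZero.pos n)
  have hvar : Var[F; Measure.pi ν] ≤ c ^ 2 / n := by
    refine (hc.variance_le hF ν).trans_eq ?_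
    rw [Finset.sum_const, Finset.card_univ, Fintype.card_fin, nsmul_eq_mul]
    field_simp
  have hthreshold : √(c ^ 2 / n / η) = c / √η * (1 / √n) := by
    rw [Real.sqrt_div (by positivity), Real.sqrt_div (by positivity), Real.sqrt_sq hc₀.le]
    ring
  have h := measure_sqrt_div_lt_abs_sub_integral_le (hc.memLp hF 2 _) hvar (by positivity) hη
  rwa [hthreshold] at h

/-- The constant `c` in the uniform deviation bound `2 R̂(f) + c / √n`, valid with probability
`1 - η` for families bounded by `B`. -/
noncomputable def deviationConst (B η : ℝ) : ℝ := 6 * B / √(η / 2)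

variable (ν : Measure E) [IsProbabilityMeasure ν] {f : T → E → ℝ} {B η : ℝ}

theorem measure_lt_signedSup_centered_le [Countable T] [Nonempty T] (hf : ∀ t, Measurable (f t))
    (hB₀ : 0 < B) (hB : ∀ t x, |f t x| ≤ B) (hη : 0 < η) :
    (Measure.pi fun _ : Fin n => ν) {S | 2 * empRademacher (Set.range f) S
        + 6 * B / √η * (1 / √n) < signedSup (centered ν f) (fun _ => true) S} ≤
      ENNReal.ofReal η := by
  set D : (Fin n → E) → ℝ := signedSup (centered ν f) fun _ => true
  set R : (Fin n → E) → ℝ := empRademacher (Set.range f)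
  have hDm : Measurable D := measurable_signedSup (fun t => (hf t).const_sub _) _
  have hRm : Measurable R := measurable_empRademacher hf
  have hDdiff : BoundedDiff D fun _ => 2 * B / n :=
    boundedDiff_signedSup (abs_centered_le ν hB) (fun t x y => by
      rw [centered, centered, sub_sub_sub_cancel_left]
      exact abs_sub_le_two_mul hB t y x) _
  have hRdiff : BoundedDiff R fun _ => 2 * B / n :=
    boundedDiff_empRademacher hB (abs_sub_le_two_mul hB)
  have hdiff : BoundedDiff (fun S => D S - 2 * R S) fun _ => 6 * B / n := fun S k x => by
    have hD := abs_le.1 (hDdiff S k x)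
    have hR := abs_le.1 (hRdiff S k x)
    have hsplit : 6 * B / n = 2 * B / n + 2 * (2 * B / n) := by ring
    exact abs_le.2 ⟨by linarith [hD.1, hR.2], by linarith [hD.2, hR.1]⟩
  have hmean : ∫ S, (D S - 2 * R S) ∂(Measure.pi fun _ : Fin n => ν) ≤ 0 := by
    rw [integral_sub (memLp_one_iff_integrable.1 (hDdiff.memLp hDm 1 _))
      ((memLp_one_iff_integrable.1 (hRdiff.memLp hRm 1 _)).const_mul 2), integral_const_mul]
    exact sub_nonpos.2 (integral_signedSup_centered_le_two_mul ν hf hB)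
  refine (measure_mono fun S hS => ?_).trans (measure_lt_abs_sub_integral_le_of_boundedDiff
    (fun _ => ν) (hDm.sub (hRm.const_mul 2)) hdiff (by positivity) hη)
  have hS' : 2 * R S + 6 * B / √η * (1 / √n) < D S := hS
  have hexceed : 6 * B / √η * (1 / √n)
      < D S - 2 * R S - ∫ S', (D S' - 2 * R S') ∂(Measure.pi fun _ : Fin n => ν) := by linarith
  exact hexceed.trans_le (le_abs_self _)

theorem measure_exists_lt_abs_deviation_le_of_countable [Countable T]
    (hf : ∀ t, Measurable (f t)) (hB₀ : 0 < B) (hB : ∀ t x, |f t x| ≤ B) (hη : 0 < η) :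
    (Measure.pi fun _ : Fin n => ν) {S | ∃ t, 2 * empRademacher (Set.range f) S
        + deviationConst B η * (1 / √n) < |∫ x, f t x ∂ν - avg fun j => f t (S j)|} ≤
      ENNReal.ofReal η := by
  rcases isEmpty_or_nonempty T with _ | _
  · simp
  have hle : ∀ {g : T → E → ℝ}, (∀ t x, |g t x| ≤ B) → ∀ t (S : Fin n → E),
      ∫ x, g t x ∂ν - avg (fun j => g t (S j)) ≤ signedSup (centered ν g) (fun _ => true) S :=
    fun {g} hg t S => by
      rw [← avg_centered, ← signedAvg_true]
      exact signedAvg_le_signedSup (fun t j => abs_centered_le ν hg t (S j)) _ t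
  have hneg : ∀ t x, |-f t x| ≤ B := fun t x => (abs_neg _).trans_le (hB t x)
  rw [← add_halves η, ENNReal.ofReal_add (half_pos hη).le (half_pos hη).le, add_halves]
  refine (measure_mono ?_).trans ((measure_union_le _ _).trans (add_le_add
    (measure_lt_signedSup_centered_le ν hf hB₀ hB (half_pos hη))
    (measure_lt_signedSup_centered_le ν (fun t => (hf t).neg) hB₀ hneg (half_pos hη))))
  rintro S ⟨t, ht⟩
  refine (lt_abs.1 ht).imp (fun h => h.trans_le (hle hB t S)) fun h => ?_
  have hflip : -(∫ x, f t x ∂ν - avg fun j => f t (S j))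
      = ∫ x, -f t x ∂ν - avg fun j => -f t (S j) := by
    rw [integral_neg, avg_neg, neg_sub, sub_neg_eq_add, neg_add_eq_sub]
  rw [Set.mem_ofPred_eq]
  exact (empRademacher_range_neg f S).symm ▸ (h.trans_eq hflip).trans_le (hle hneg t S)

theorem measure_exists_lt_abs_deviation_le_of_forall_abs_le [TopologicalSpace T]
    [SecondCountableTopology T] (hf : ∀ t, Measurable (f t))
    (hcont : ∀ x, Continuous fun t => f t x) (hB₀ : 0 < B) (hB : ∀ t x, |f t x| ≤ B) (hη : 0 < η) :
    (Measure.pi fun _ : Fin n => ν) {S | ∃ t, 2 * empRademacher (Set.range f) S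
        + deviationConst B η * (1 / √n) < |∫ x, f t x ∂ν - avg fun j => f t (S j)|} ≤
      ENNReal.ofReal η := by
  rcases isEmpty_or_nonempty T with _ | _
  · simp
  have hint : Continuous fun t => ∫ x, f t x ∂ν :=
    continuous_of_dominated (fun t => (hf t).aestronglyMeasurable) (fun t => .of_forall (hB t))
      (integrable_const B) (.of_forall hcont)
  have hdev : ∀ S : Fin n → E, Continuous fun t => |∫ x, f t x ∂ν - avg fun j => f t (S j)| :=
    fun S => (hint.sub (continuous_const.mul
      (continuous_finsetSum _ fun j _ => hcont (S j)))).abs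
  refine (measure_mono ?_).trans (measure_exists_lt_abs_deviation_le_of_countable ν
    (fun k => hf (TopologicalSpace.denseSeq T k)) hB₀ (fun k => hB _) hη)
  rintro S ⟨t, ht⟩
  have hR := empRademacher_range_comp_le (fun t j => hB t (S j)) (TopologicalSpace.denseSeq T)
  obtain ⟨k, hk⟩ := (TopologicalSpace.denseRange_denseSeq T).exists_mem_open
    (isOpen_lt continuous_const (hdev S)) ⟨t, ht⟩
  have hk' : 2 * empRademacher (Set.range f) S + deviationConst B η * (1 / √n)
    < |∫ x, f (TopologicalSpace.denseSeq T k) x ∂ν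
      - avg fun j => f (TopologicalSpace.denseSeq T k) (S j)| := hk
  exact ⟨k, lt_of_le_of_lt (by linarith) hk'⟩

theorem measure_exists_lt_abs_deviation_le [TopologicalSpace T] [SecondCountableTopology T]
    (hf : ∀ t, Measurable (f t)) (hcont : ∀ x, Continuous fun t => f t x) (hB₀ : 0 < B)
    (hB : ∀ᵐ x ∂ν, ∀ t, |f t x| ≤ B) (hη : 0 < η) :
    (Measure.pi fun _ : Fin n => ν) {S | ∃ t, 2 * empRademacher (Set.range f) S
        + deviationConst B η * (1 / √n) < |∫ x, f t x ∂ν - avg fun j => f t (S j)|} ≤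
      ENNReal.ofReal η := by
  obtain ⟨s, hs, hsm, hsB⟩ := hB.exists_measurable_mem
  set g : T → E → ℝ := fun t => s.indicator (f t)
  have hgf : ∀ t, ∀ x ∈ s, g t x = f t x := fun t x hx => Set.indicator_of_mem hx _
  have hgcont : ∀ x, Continuous fun t => g t x := fun x => by
    by_cases hx : x ∈ s
    · simpa only [hgf _ x hx] using hcont x
    · simpa only [g, Set.indicator_of_notMem hx] using continuous_const
  have hgB : ∀ t x, |g t x| ≤ B := fun t x => by
    by_cases hx : x ∈ s
    · exact (hgf t x hx).symm ▸ hsB x hx t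
    · simpa [g, hx] using hB₀.le
  have hgint : ∀ t, ∫ x, g t x ∂ν = ∫ x, f t x ∂ν := fun t =>
    integral_congr_ae (Filter.mem_of_superset hs (hgf t))
  refine (measure_mono_ae ?_).trans (measure_exists_lt_abs_deviation_le_of_forall_abs_le ν
    (fun t => (hf t).indicator hsm) hgcont hB₀ hgB hη)
  have hmem : ∀ᵐ S ∂(Measure.pi fun _ : Fin n => ν), ∀ j, S j ∈ s :=
    ae_all_iff.2 fun j => (measurePreserving_eval (fun _ => ν) j).quasiMeasurePreserving.ae hs
  filter_upwards [hmem] with S hS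
  rintro ⟨t, ht⟩
  refine ⟨t, ?_⟩
  simp only [empRademacher_range, signedSup] at ht ⊢
  simpa only [g, Set.indicator_of_mem (hS _), hgint] using ht

end UniformDeviation

section Samples

variable {E T Ω' : Type*} [MeasurableSpace E] [MeasurableSpace Ω'] {Q : Measure Ω'}
  [IsProbabilityMeasure Q] {ν : Measure E} {n : ℕ} {S : Fin n → Ω' → E} {B η : ℝ}

theorem IsIIDSample.measurePreserving (hS : IsIIDSample Q ν S) :
    MeasurePreserving (fun ω j => S j ω) Q (Measure.pi fun _ : Fin n => ν) := by
  refine ⟨measurable_pi_iff.2 hS.1, ?_⟩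
  rw [(iIndepFun_iff_map_fun_eq_pi_map fun j => (hS.1 j).aemeasurable).1 hS.2.1]
  exact congrArg Measure.pi (funext hS.2.2)

variable [IsProbabilityMeasure ν] [NeZero n]

theorem IsIIDSample.measure_exists_lt_abs_deviation_le [TopologicalSpace T]
    [SecondCountableTopology T] (hS : IsIIDSample Q ν S) {f : T → E → ℝ}
    (hf : ∀ t, Measurable (f t)) (hcont : ∀ x, Continuous fun t => f t x) (hB₀ : 0 < B)
    (hB : ∀ᵐ x ∂ν, ∀ t, |f t x| ≤ B) (hη : 0 < η) :
    Q {ω | ∃ t, 2 * empRademacher (Set.range f) (fun j => S j ω)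
        + deviationConst B η * (1 / √n) < |∫ x, f t x ∂ν - avg fun j => f t (S j ω)|} ≤
      ENNReal.ofReal η := by
  refine le_trans ?_ (DFPV.measure_exists_lt_abs_deviation_le (n := n) ν hf hcont hB₀ hB hη)
  rw [← hS.measurePreserving.map_eq]
  exact Measure.le_map_apply hS.measurePreserving.aemeasurable _

theorem IsIIDSample.measure_lt_abs_heldOut_deviation_le {R : Type*} [MeasurableSpace R]
    (hS : IsIIDSample Q ν S) {φ : R → E → ℝ} (hφ : Measurable (Function.uncurry φ)) {r : Ω' → R}
    (hr : Measurable r) (hind : IndepFun r (fun ω j => S j ω) Q) (hB₀ : 0 < B)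
    (hB : ∀ᵐ ω ∂Q, ∀ᵐ x ∂ν, |φ (r ω) x| ≤ B) (hη : 0 < η) :
    Q {ω | deviationConst B η * (1 / √n) <
      |∫ x, φ (r ω) x ∂ν - avg fun j => φ (r ω) (S j ω)|} ≤ ENNReal.ofReal η := by
  set D : Set (R × (Fin n → E)) := {p | deviationConst B η * (1 / √n) <
    |∫ x, φ p.1 x ∂ν - avg fun j => φ p.1 (p.2 j)|}
  have hD : MeasurableSet D := by
    refine measurableSet_lt measurable_const (Measurable.abs (Measurable.sub ?_ ?_))
    · exact (hφ.stronglyMeasurable.integral_prod_right (ν := ν)).measurable.comp measurable_fst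
    · exact measurable_avg fun j => hφ.comp
        (measurable_fst.prodMk ((measurable_pi_apply j).comp measurable_snd))
  have hSm := hS.measurePreserving.measurable
  have hset : {ω | deviationConst B η * (1 / √n) <
      |∫ x, φ (r ω) x ∂ν - avg fun j => φ (r ω) (S j ω)|}
      = (fun ω => (r ω, fun j => S j ω)) ⁻¹' D := rfl
  rw [hset, ← Measure.map_apply (hr.prodMk hSm) hD,
    (indepFun_iff_map_prod_eq_prod_map_map hr.aemeasurable hSm.aemeasurable).1 hind,
    hS.measurePreserving.map_eq, Measure.prod_apply hD,
    lintegral_map (measurable_measure_prodMk_left hD) hr]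
  refine (lintegral_mono_ae ?_).trans_eq (by rw [lintegral_const, measure_univ, mul_one])
  filter_upwards [hB] with ω hω
  have h := DFPV.measure_exists_lt_abs_deviation_le (n := n) ν (f := fun _ : Unit => φ (r ω))
    (fun _ => hφ.comp measurable_prodMk_left) (fun _ => continuous_const) hB₀
    (hω.mono fun x hx _ => hx) hη
  simp only [Set.range_const, empRademacher_singleton, mul_zero, zero_add, exists_const] at h
  exact h

end Samples

section ConditionalIndependence

variable {Ω β β' γ : Type*} [MeasurableSpace Ω] [StandardBorelSpace Ω] [MeasurableSpace β]
  [StandardBorelSpace β] [Nonempty β] [MeasurableSpace β'] [mγ : MeasurableSpace γ]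

theorem condDistrib_prodMk_ae_eq_of_condIndepFun {μ : Measure Ω} [IsFiniteMeasure μ] {f : Ω → β}
    {g : Ω → β'} {k : Ω → γ} (hf : Measurable f) (hg : Measurable g) (hk : Measurable k)
    (h : CondIndepFun (MeasurableSpace.comap k mγ) hk.comap_le g f μ) :
    condDistrib f (fun ω => (k ω, g ω)) μ =ᵐ[μ.map fun ω => (k ω, g ω)]
      (condDistrib f k μ).prodMkRight β' := by
  rw [condDistrib_ae_eq_iff_measure_eq_compProd _ hf.aemeasurable]
  refine Measure.ext_prod₃_iff'.2 fun {s t u} hs ht hu => ?_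
  -- `β'` need not be standard Borel: the library's criterion applies to the indicator of `g ∈ t`.
  set φ : β' → ℝ := t.indicator 1
  have hφ : Measurable φ := measurable_one.indicator ht
  have hφg : Measurable (φ ∘ g) := hφ.comp hg
  have hφt : φ ⁻¹' {1} = t := by
    ext y
    by_cases hy : y ∈ t <;> simp [φ, hy]
  have hindicator : CondIndepFun (MeasurableSpace.comap k mγ) hk.comap_le (φ ∘ g) f μ :=
    h.comp hφ measurable_id
  rw [condIndepFun_iff_condDistrib_prod_ae_eq_prodMkRight hf hφg hk,
    condDistrib_ae_eq_iff_measure_eq_compProd _ hf.aemeasurable] at hindicator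
  have hone : MeasurableSet ({1} : Set ℝ) := measurableSet_singleton 1
  have hrect := congrArg (fun m => m ((s ×ˢ {1}) ×ˢ u)) hindicator
  have hset : (fun ω => (k ω, (φ ∘ g) ω)) ⁻¹' (s ×ˢ {1}) = (fun ω => (k ω, g ω)) ⁻¹' (s ×ˢ t) := by
    rw [Set.mk_preimage_prod, Set.mk_preimage_prod, Set.preimage_comp, hφt]
  rw [Measure.map_apply ((hk.prodMk hφg).prodMk hf) ((hs.prod hone).prod hu),
    Measure.compProd_apply_prod (hs.prod hone) hu, setLIntegral_map (hs.prod hone)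
      (Kernel.measurable_coe _ hu) (hk.prodMk hφg), Set.mk_preimage_prod, hset] at hrect
  rw [Measure.map_apply ((hk.prodMk hg).prodMk hf) ((hs.prod ht).prod hu),
    Measure.compProd_apply_prod (hs.prod ht) hu, setLIntegral_map (hs.prod ht)
      (Kernel.measurable_coe _ hu) (hk.prodMk hg), Set.mk_preimage_prod, hrect]
  rfl

end ConditionalIndependence

section SquareIntegrable

variable {α : Type*} {m m₀ : MeasurableSpace α} {μ : Measure α}

theorem lpNorm_two_eq_sqrt_integral_sq {f : α → ℝ} (hf : AEStronglyMeasurable f μ) :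
    lpNorm f 2 μ = √(∫ x, f x ^ 2 ∂μ) := by
  rw [lpNorm_eq_integral_norm_rpow_toReal two_ne_zero ENNReal.ofNat_ne_top hf, Real.sqrt_eq_rpow]
  simp

theorem lintegral_enorm_le_mul_eLpNorm_of_rnDeriv {ν₁ ν₂ : Measure α} [IsFiniteMeasure ν₁]
    [IsFiniteMeasure ν₂] (hac : ν₁ ≪ ν₂) {ρ : ℝ≥0}
    (hρ : ∫⁻ x, (ν₁.rnDeriv ν₂ x) ^ 2 ∂ν₂ ≤ (ρ : ℝ≥0∞) ^ 2) {g : α → ℝ} (hg : Measurable g) :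
    ∫⁻ x, ‖g x‖ₑ ∂ν₁ ≤ ρ * eLpNorm g 2 ν₂ := by
  have hnorm : (∫⁻ x, ν₁.rnDeriv ν₂ x ^ (2 : ℝ) ∂ν₂) ^ (1 / 2 : ℝ) ≤ ρ := by
    rw [one_div, ENNReal.rpow_inv_le_iff two_pos]
    simpa only [ENNReal.rpow_two] using hρ
  rw [← lintegral_rnDeriv_mul hac hg.enorm.aemeasurable,
    eLpNorm_eq_lintegral_rpow_enorm_toReal two_ne_zero ENNReal.ofNat_ne_top]
  exact (ENNReal.lintegral_mul_le_Lp_mul_Lq ν₂ Real.HolderConjugate.two_two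
    (Measure.measurable_rnDeriv _ _).aemeasurable hg.enorm.aemeasurable).trans
      (mul_le_mul_left hnorm _)

theorem lpNorm_le_mul_lpNorm_of_eLpNorm_div_le {f g : α → ℝ} (hf : MemLp f 2 μ) (hg : MemLp g 2 μ)
    {τ : ℝ≥0} (h : eLpNorm f 2 μ / eLpNorm g 2 μ ≤ τ) : lpNorm f 2 μ ≤ τ * lpNorm g 2 μ := by
  rw [ENNReal.div_le_iff_le_mul (.inr ENNReal.coe_ne_top) (.inl hg.2.ne)] at h
  rw [← toReal_eLpNorm hf.1, ← toReal_eLpNorm hg.1, ← ENNReal.coe_toReal, ← ENNReal.toReal_mul]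
  exact ENNReal.toReal_mono (ENNReal.mul_ne_top ENNReal.coe_ne_top hg.2.ne) h

variable [IsProbabilityMeasure μ]

theorem integral_sub_condExp_mul_eq_zero (hm : m ≤ m₀) {f g : α → ℝ} (hf : MemLp f 2 μ)
    (hg : MemLp g 2 μ) (hgm : StronglyMeasurable[m] g) :
    ∫ x, (f x - (μ[f | m]) x) * g x ∂μ = 0 := by
  have hfc : MemLp (f - μ[f | m]) 2 μ := hf.sub (hf.condExp one_le_two)
  have hres : μ[f - μ[f | m] | m] =ᵐ[μ] 0 := by
    refine (condExp_sub (hf.integrable one_le_two) integrable_condExp m).trans ?_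
    rw [condExp_of_stronglyMeasurable hm stronglyMeasurable_condExp integrable_condExp, sub_self]
  have hpull : μ[(f - μ[f | m]) * g | m] =ᵐ[μ] 0 := by
    refine (condExp_mul_of_stronglyMeasurable_right hgm (hfc.integrable_mul hg)
      (hfc.integrable one_le_two)).trans ?_
    filter_upwards [hres] with x hx
    rw [Pi.mul_apply, hx, Pi.zero_apply, zero_mul]
  exact (integral_condExp hm).symm.trans (integral_eq_zero_of_ae hpull)

theorem integral_sub_sq_eq_add (hm : m ≤ m₀) {f g : α → ℝ} (hf : MemLp f 2 μ)
    (hg : MemLp g 2 μ) (hgm : StronglyMeasurable[m] g) :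
    ∫ x, (f x - g x) ^ 2 ∂μ =
      ∫ x, ((μ[f | m]) x - g x) ^ 2 ∂μ + ∫ x, (f x - (μ[f | m]) x) ^ 2 ∂μ := by
  set e := μ[f | m]
  have he : MemLp e 2 μ := hf.condExp one_le_two
  have hfe : MemLp (fun x => f x - e x) 2 μ := hf.sub he
  have heg : MemLp (fun x => e x - g x) 2 μ := he.sub hg
  have hprod : Integrable (fun x => 2 * ((f x - e x) * (e x - g x))) μ :=
    (hfe.integrable_mul heg).const_mul 2
  have hcross : ∫ x, (f x - e x) * (e x - g x) ∂μ = 0 :=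
    integral_sub_condExp_mul_eq_zero hm hf heg (stronglyMeasurable_condExp.sub hgm)
  have hexpand : ∀ x, (f x - g x) ^ 2
      = (e x - g x) ^ 2 + (f x - e x) ^ 2 + 2 * ((f x - e x) * (e x - g x)) := fun x => by ring
  simp_rw [hexpand]
  rw [integral_add (f := fun x => (e x - g x) ^ 2 + (f x - e x) ^ 2)
      (heg.integrable_sq.add hfe.integrable_sq) hprod, integral_const_mul, hcross, mul_zero,
    add_zero, integral_add heg.integrable_sq hfe.integrable_sq]

end SquareIntegrable

namespace Population

variable {Ω 𝒰 𝒜 𝒵 𝒲 𝒞 : Type*} [MeasurableSpace Ω] [MeasurableSpace 𝒰] [MeasurableSpace 𝒜]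
  [MeasurableSpace 𝒵] [MeasurableSpace 𝒲] [MeasurableSpace 𝒞] {P : Population Ω 𝒰 𝒜 𝒵 𝒲 𝒞}
  {g h : 𝒜 × 𝒲 → ℝ} {π : 𝒞 → 𝒜} {ρ τ : ℝ≥0} {M : ℝ}

theorem measurable_outcomeMean : Measurable P.outcomeMean :=
  (measurable_snd.stronglyMeasurable.integral_condDistrib (Y := P.Y)
    (X := fun ω => (P.A ω, P.U ω)) (μ := P.μ)).measurable

theorem memLp_Y (hY : ∀ᵐ ω ∂P.μ, |P.Y ω| ≤ M) : MemLp P.Y 2 P.μ :=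
  MemLp.of_bound P.measurable_Y.aestronglyMeasurable M hY

theorem sigmaAZ_le : P.sigmaAZ ≤ ‹MeasurableSpace Ω› :=
  (P.measurable_A.prodMk P.measurable_Z).comap_le

theorem stronglyMeasurable_comp_AZ {f : 𝒜 × 𝒵 → ℝ} (hf : Measurable f) :
    StronglyMeasurable[P.sigmaAZ] fun ω => f (P.A ω, P.Z ω) :=
  (hf.comp (comap_measurable fun ω => (P.A ω, P.Z ω))).stronglyMeasurable

theorem lintegral_enorm_policy_le (hπ : Measurable π) (hρ : P.PolicyL2 π ρ) (hg : Measurable g) :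
    ∫⁻ ω, ‖g (π (P.C ω), P.W ω)‖ₑ ∂P.μ ≤ ρ * eLpNorm (fun ω => g (P.A ω, P.W ω)) 2 P.μ := by
  have hπW : Measurable fun ω => (π (P.C ω), P.W ω) :=
    (hπ.comp P.measurable_C).prodMk P.measurable_W
  have h := lintegral_enorm_le_mul_eLpNorm_of_rnDeriv hρ.1 hρ.2 hg
  rwa [lintegral_map hg.enorm hπW, eLpNorm_map_measure hg.aestronglyMeasurable
    (P.measurable_A.prodMk P.measurable_W).aemeasurable] at h

theorem integrable_policy (hπ : Measurable π) (hρ : P.PolicyL2 π ρ) (hg : Measurable g)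
    (hL : MemLp (fun ω => g (P.A ω, P.W ω)) 2 P.μ) :
    Integrable (fun ω => g (π (P.C ω), P.W ω)) P.μ :=
  ⟨(hg.comp ((hπ.comp P.measurable_C).prodMk P.measurable_W)).aestronglyMeasurable,
    (lintegral_enorm_policy_le hπ hρ hg).trans_lt (ENNReal.mul_lt_top ENNReal.coe_lt_top hL.2)⟩

theorem abs_integral_policy_le (hπ : Measurable π) (hρ : P.PolicyL2 π ρ) (hg : Measurable g)
    (hL : MemLp (fun ω => g (P.A ω, P.W ω)) 2 P.μ) :
    |∫ ω, g (π (P.C ω), P.W ω) ∂P.μ| ≤ ρ * lpNorm (fun ω => g (P.A ω, P.W ω)) 2 P.μ := by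
  rw [← toReal_eLpNorm hL.1, ← ENNReal.coe_toReal, ← ENNReal.toReal_mul, ← Real.norm_eq_abs,
    ← toReal_enorm]
  exact ENNReal.toReal_mono (ENNReal.mul_ne_top ENNReal.coe_ne_top hL.2.ne)
    ((enorm_integral_le_lintegral_enorm _).trans (lintegral_enorm_policy_le hπ hρ hg))

theorem condExp_Y_ae_eq_outcomeMean [StandardBorelSpace Ω] (hS : P.Structural)
    (hY : ∀ᵐ ω ∂P.μ, |P.Y ω| ≤ M) :
    P.μ[P.Y | MeasurableSpace.comap (fun ω => ((P.A ω, P.U ω), P.Z ω)) inferInstance] =ᵐ[P.μ]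
      fun ω => P.outcomeMean (P.A ω, P.U ω) := by
  have hAU := P.measurable_A.prodMk P.measurable_U
  have hAUZ := hAU.prodMk P.measurable_Z
  refine (condExp_ae_eq_integral_condDistrib' hAUZ ((memLp_Y hY).integrable one_le_two)).trans ?_
  filter_upwards [ae_of_ae_map hAUZ.aemeasurable (condDistrib_prodMk_ae_eq_of_condIndepFun
    P.measurable_Y P.measurable_Z hAU hS.1.symm)] with ω hω
  rw [hω]
  rfl

theorem condExp_bridge_sub_ae_eq (hB : P.IsBridge h)
    (hL : MemLp (fun ω => g (P.A ω, P.W ω)) 2 P.μ) :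
    P.μ[fun ω => h (P.A ω, P.W ω) - g (P.A ω, P.W ω) | P.sigmaAZ] =ᵐ[P.μ]
      P.μ[P.Y | P.sigmaAZ] - P.μ[fun ω => g (P.A ω, P.W ω) | P.sigmaAZ] := by
  refine (condExp_sub (hB.2.1.integrable one_le_two) (hL.integrable one_le_two) _).trans ?_
  exact hB.2.2.symm.sub .rfl

variable [StandardBorelSpace 𝒲] [Nonempty 𝒲]

/-- The function `(a, u) ↦ E[h(a, W) | U = u]`, which identifies the outcome mean
`E[Y | A = a, U = u]` when `h` is a bridge function. -/
noncomputable def bridgeMean (P : Population Ω 𝒰 𝒜 𝒵 𝒲 𝒞) (h : 𝒜 × 𝒲 → ℝ) (x : 𝒜 × 𝒰) : ℝ :=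
  ∫ w, h (x.1, w) ∂(condDistrib P.W P.U P.μ x.2)

theorem measurable_bridgeMean (hh : Measurable h) : Measurable (P.bridgeMean h) := by
  have hjoint : StronglyMeasurable fun p : (𝒜 × 𝒰) × 𝒲 => h (p.1.1, p.2) :=
    (hh.comp ((measurable_fst.comp measurable_fst).prodMk measurable_snd)).stronglyMeasurable
  exact (hjoint.integral_kernel_prod_right'
    (κ := (condDistrib P.W P.U P.μ).prodMkLeft 𝒜)).measurable

variable [StandardBorelSpace Ω]

theorem condExp_ae_eq_bridgeMean (hS : P.Structural) (hh : Measurable h)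
    (hL : MemLp (fun ω => h (P.A ω, P.W ω)) 2 P.μ) :
    P.μ[fun ω => h (P.A ω, P.W ω) |
        MeasurableSpace.comap (fun ω => (P.U ω, (P.A ω, P.Z ω))) inferInstance] =ᵐ[P.μ]
      fun ω => P.bridgeMean h (P.A ω, P.U ω) := by
  have hAZ := P.measurable_A.prodMk P.measurable_Z
  have hUAZ := P.measurable_U.prodMk hAZ
  have hjoint : StronglyMeasurable fun p : (𝒰 × 𝒜 × 𝒵) × 𝒲 => h (p.1.2.1, p.2) :=
    (hh.comp ((measurable_fst.comp (measurable_snd.comp measurable_fst)).prodMk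
      measurable_snd)).stronglyMeasurable
  refine (condExp_prod_ae_eq_integral_condDistrib hUAZ P.measurable_W.aemeasurable hjoint
    (hL.integrable one_le_two)).trans ?_
  filter_upwards [ae_of_ae_map hUAZ.aemeasurable (condDistrib_prodMk_ae_eq_of_condIndepFun
    P.measurable_W hAZ P.measurable_U hS.2.symm)] with ω hω
  rw [hω]
  rfl

theorem condExp_policy_ae_eq_bridgeMean (hI : P.PolicyVariableIndep) (hπ : Measurable π)
    (hρ : P.PolicyL2 π ρ) (hh : Measurable h) (hL : MemLp (fun ω => h (P.A ω, P.W ω)) 2 P.μ) :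
    P.μ[fun ω => h (π (P.C ω), P.W ω) |
        MeasurableSpace.comap (fun ω => (P.U ω, P.C ω)) inferInstance] =ᵐ[P.μ]
      fun ω => P.bridgeMean h (π (P.C ω), P.U ω) := by
  have hUC := P.measurable_U.prodMk P.measurable_C
  have hjoint : StronglyMeasurable fun p : (𝒰 × 𝒞) × 𝒲 => h (π p.1.2, p.2) :=
    (hh.comp ((hπ.comp (measurable_snd.comp measurable_fst)).prodMk
      measurable_snd)).stronglyMeasurable
  refine (condExp_prod_ae_eq_integral_condDistrib hUC P.measurable_W.aemeasurable hjoint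
    (integrable_policy hπ hρ hh hL)).trans ?_
  filter_upwards [ae_of_ae_map hUC.aemeasurable (condDistrib_prodMk_ae_eq_of_condIndepFun
    P.measurable_W P.measurable_C P.measurable_U hI)] with ω hω
  rw [hω]
  rfl

theorem outcomeMean_ae_eq_bridgeMean (hS : P.Structural) (hC : P.ConfounderComplete)
    (hB : P.IsBridge h) (hY : ∀ᵐ ω ∂P.μ, |P.Y ω| ≤ M) :
    (fun ω => P.outcomeMean (P.A ω, P.U ω) - P.bridgeMean h (P.A ω, P.U ω)) =ᵐ[P.μ] 0 := by
  obtain ⟨hh, hL, hbridge⟩ := hB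
  have hAUZ : Measurable fun ω => ((P.A ω, P.U ω), P.Z ω) :=
    (P.measurable_A.prodMk P.measurable_U).prodMk P.measurable_Z
  have hUAZ : Measurable fun ω => (P.U ω, (P.A ω, P.Z ω)) :=
    P.measurable_U.prodMk (P.measurable_A.prodMk P.measurable_Z)
  have houtcome := condExp_Y_ae_eq_outcomeMean hS hY
  have hmean := condExp_ae_eq_bridgeMean hS hh hL
  have hL₁ : MemLp (fun ω => P.outcomeMean (P.A ω, P.U ω)) 2 P.μ :=
    (memLp_congr_ae houtcome).1 ((memLp_Y hY).condExp one_le_two)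
  have hL₂ : MemLp (fun ω => P.bridgeMean h (P.A ω, P.U ω)) 2 P.μ :=
    (memLp_congr_ae hmean).1 (hL.condExp one_le_two)
  have htower₁ : P.μ[fun ω => P.outcomeMean (P.A ω, P.U ω) | P.sigmaAZ] =ᵐ[P.μ]
      P.μ[P.Y | P.sigmaAZ] :=
    (condExp_congr_ae houtcome.symm).trans (condExp_condExp_of_le (measurable_iff_comap_le.1
      (((measurable_fst.comp measurable_fst).prodMk measurable_snd).comp
        (comap_measurable fun ω => ((P.A ω, P.U ω), P.Z ω)))) hAUZ.comap_le)
  have htower₂ : P.μ[fun ω => P.bridgeMean h (P.A ω, P.U ω) | P.sigmaAZ] =ᵐ[P.μ]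
      P.μ[fun ω => h (P.A ω, P.W ω) | P.sigmaAZ] :=
    (condExp_congr_ae hmean.symm).trans (condExp_condExp_of_le (measurable_iff_comap_le.1
      (measurable_snd.comp (comap_measurable fun ω => (P.U ω, (P.A ω, P.Z ω))))) hUAZ.comap_le)
  refine (hC (fun x => P.outcomeMean x - P.bridgeMean h x)
    (measurable_outcomeMean.sub (measurable_bridgeMean hh)) (hL₁.sub hL₂)).1 ?_
  refine (condExp_sub (hL₁.integrable one_le_two) (hL₂.integrable one_le_two) _).trans ?_
  filter_upwards [htower₁, htower₂, hbridge] with ω h₁ h₂ h₃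
  rw [Pi.sub_apply, h₁, h₂, h₃, sub_self, Pi.zero_apply]

theorem value_eq_integral_bridge (hS : P.Structural) (hI : P.PolicyVariableIndep)
    (hC : P.ConfounderComplete) (hB : P.IsBridge h) (hY : ∀ᵐ ω ∂P.μ, |P.Y ω| ≤ M)
    (hπ : Measurable π) (hO : P.Overlap π) (hρ : P.PolicyL2 π ρ) :
    P.value π = ∫ ω, h (π (P.C ω), P.W ω) ∂P.μ := by
  have hmeas : MeasurableSet {x | P.outcomeMean x - P.bridgeMean h x = 0} :=
    (measurable_outcomeMean.sub (measurable_bridgeMean hB.1)) (measurableSet_singleton 0)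
  have hAU : ∀ᵐ x ∂(P.μ.map fun ω => (P.A ω, P.U ω)), P.outcomeMean x - P.bridgeMean h x = 0 :=
    (ae_map_iff (P.measurable_A.prodMk P.measurable_U).aemeasurable hmeas).2
      (outcomeMean_ae_eq_bridgeMean hS hC hB hY)
  have hπU : ∀ᵐ ω ∂P.μ,
      P.outcomeMean (π (P.C ω), P.U ω) - P.bridgeMean h (π (P.C ω), P.U ω) = 0 :=
    ae_of_ae_map ((hπ.comp P.measurable_C).prodMk P.measurable_U).aemeasurable (hO.ae_le hAU)
  rw [value, ← integral_condExp (P.measurable_U.prodMk P.measurable_C).comap_le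
    (f := fun ω => h (π (P.C ω), P.W ω))]
  refine integral_congr_ae ?_
  filter_upwards [hπU, condExp_policy_ae_eq_bridgeMean hI hπ hρ hB.1 hB.2.1] with ω h₁ h₂
  rw [h₂, sub_eq_zero.1 h₁]

theorem abs_value_sub_integral_le (hS : P.Structural) (hI : P.PolicyVariableIndep)
    (hC : P.ConfounderComplete) (hB : P.IsBridge h) (hY : ∀ᵐ ω ∂P.μ, |P.Y ω| ≤ M)
    (hπ : Measurable π) (hO : P.Overlap π) (hρ : P.PolicyL2 π ρ) (hg : Measurable g)
    (hL : MemLp (fun ω => g (P.A ω, P.W ω)) 2 P.μ)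
    (hτ : eLpNorm (fun ω => h (P.A ω, P.W ω) - g (P.A ω, P.W ω)) 2 P.μ /
      eLpNorm (P.μ[fun ω => h (P.A ω, P.W ω) - g (P.A ω, P.W ω) | P.sigmaAZ]) 2 P.μ ≤ τ) :
    |P.value π - ∫ ω, g (π (P.C ω), P.W ω) ∂P.μ| ≤ ρ * (τ * lpNorm
      (P.μ[P.Y | P.sigmaAZ] - P.μ[fun ω => g (P.A ω, P.W ω) | P.sigmaAZ]) 2 P.μ) := by
  have hd : MemLp (fun ω => h (P.A ω, P.W ω) - g (P.A ω, P.W ω)) 2 P.μ := hB.2.1.sub hL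
  have hcond := condExp_bridge_sub_ae_eq hB hL
  have hdc : MemLp (P.μ[P.Y | P.sigmaAZ] - P.μ[fun ω => g (P.A ω, P.W ω) | P.sigmaAZ]) 2 P.μ :=
    (memLp_congr_ae hcond).1 (hd.condExp one_le_two)
  rw [eLpNorm_congr_ae hcond] at hτ
  rw [value_eq_integral_bridge hS hI hC hB hY hπ hO hρ,
    ← integral_sub (integrable_policy hπ hρ hB.1 hB.2.1) (integrable_policy hπ hρ hg hL)]
  exact (abs_integral_policy_le hπ hρ (hB.1.sub hg) hd).trans (mul_le_mul_of_nonneg_left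
    (lpNorm_le_mul_lpNorm_of_eLpNorm_div_le hd hdc hτ) ρ.coe_nonneg)

end Population

section SqNorm

variable {ι κ : Type*} [Fintype ι] [Fintype κ]

theorem sqNorm_nonneg (x : ι → ℝ) : 0 ≤ sqNorm x :=
  Finset.sum_nonneg fun _ _ => sq_nonneg _

theorem sqFrob_nonneg (V : Matrix ι κ ℝ) : 0 ≤ sqFrob V :=
  Finset.sum_nonneg fun i _ => sqNorm_nonneg (V i)

theorem abs_apply_le_of_sqNorm_le {x : ι → ℝ} {M : ℝ} (h : sqNorm x ≤ M ^ 2) (j : ι) :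
    |x j| ≤ |M| :=
  sq_le_sq.1 ((Finset.single_le_sum (f := fun j => x j ^ 2) (fun _ _ => sq_nonneg _)
    (Finset.mem_univ j)).trans h)

theorem sqNorm_sub_le (x y : ι → ℝ) : sqNorm (x - y) ≤ 2 * (sqNorm x + sqNorm y) := by
  rw [sqNorm, sqNorm, sqNorm, ← Finset.sum_add_distrib, Finset.mul_sum]
  refine Finset.sum_le_sum fun j _ => ?_
  rw [Pi.sub_apply, sub_eq_add_neg, ← neg_sq (y j)]
  exact add_sq_le

theorem dotProduct_sq_le (x y : ι → ℝ) : (x ⬝ᵥ y) ^ 2 ≤ sqNorm x * sqNorm y :=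
  Finset.sum_mul_sq_le_sq_mul_sq _ _ _

theorem abs_dotProduct_le {x y : ι → ℝ} {M : ℝ} (hx : sqNorm x ≤ M ^ 2) (hy : sqNorm y ≤ 1) :
    |x ⬝ᵥ y| ≤ |M| :=
  sq_le_sq.1 ((dotProduct_sq_le x y).trans
    ((mul_le_of_le_one_right (sqNorm_nonneg x) hy).trans hx))

end SqNorm

namespace FeatureModel

variable {𝒜 𝒵 𝒲 : Type*} [MeasurableSpace 𝒜] [MeasurableSpace 𝒵] [MeasurableSpace 𝒲]
  {F : FeatureModel 𝒜 𝒵 𝒲} {M : ℝ} {q : F.Par2} {p : F.Par1} {θ : F.ParW}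

/-- The vector representing the linear functional `v ↦ uᵀ (ψ_{θ_{A(2)}}(a) ⊗ v)`, through which
both the bridge functions and the stage 2 predictions of the model factor. -/
noncomputable def coef (F : FeatureModel 𝒜 𝒵 𝒲) (q : F.Par2) (a : 𝒜) (j : Fin F.dψW) : ℝ :=
  ∑ i, q.1 (i, j) * F.ψA q.2 a i

theorem dotProduct_kron_eq_coef_dotProduct (q : F.Par2) (a : 𝒜) (v : Fin F.dψW → ℝ) :
    q.1 ⬝ᵥ kron (F.ψA q.2 a) v = F.coef q a ⬝ᵥ v := by
  simp only [dotProduct, kron, coef, Fintype.sum_prod_type_right, Finset.sum_mul, mul_assoc]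

theorem pred2_eq_coef_dotProduct (q : F.Par2) (p : F.Par1) (a : 𝒜) (z : 𝒵) :
    F.pred2 q p a z = F.coef q a ⬝ᵥ F.pred1 p a z :=
  dotProduct_kron_eq_coef_dotProduct q a _

theorem bridge_eq_coef_dotProduct (q : F.Par2) (θ : F.ParW) (x : 𝒜 × 𝒲) :
    F.bridge q θ x = F.coef q x.1 ⬝ᵥ F.ψW θ x.2 :=
  dotProduct_kron_eq_coef_dotProduct q x.1 _

theorem measurable_coef (q : F.Par2) (j : Fin F.dψW) : Measurable fun a => F.coef q a j :=
  Finset.measurable_fun_sum _ fun i _ =>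
    ((measurable_pi_apply i).comp (F.measurable_ψA q.2)).const_mul _

theorem measurable_ψW_apply (θ : F.ParW) (j : Fin F.dψW) : Measurable fun w => F.ψW θ w j :=
  (measurable_pi_apply j).comp (F.measurable_ψW θ)

theorem measurable_pred1_apply (p : F.Par1) (j : Fin F.dψW) :
    Measurable fun x : 𝒜 × 𝒵 => F.pred1 p x.1 x.2 j :=
  Finset.measurable_fun_sum _ fun k _ =>
    ((((measurable_pi_apply k.1).comp (F.measurable_φA p.2.1)).comp measurable_fst).mul
      (((measurable_pi_apply k.2).comp (F.measurable_φZ p.2.2)).comp measurable_snd)).const_mul _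

theorem measurable_pred2 (q : F.Par2) (p : F.Par1) :
    Measurable fun x : 𝒜 × 𝒵 => F.pred2 q p x.1 x.2 := by
  simp_rw [pred2_eq_coef_dotProduct]
  exact Finset.measurable_fun_sum _ fun j _ =>
    ((measurable_coef q j).comp measurable_fst).mul (measurable_pred1_apply p j)

theorem measurable_bridge (q : F.Par2) (θ : F.ParW) : Measurable (F.bridge q θ) := by
  rw [funext (bridge_eq_coef_dotProduct q θ)]
  exact Finset.measurable_fun_sum _ fun j _ =>
    ((measurable_coef q j).comp measurable_fst).mul ((measurable_ψW_apply θ j).comp measurable_snd)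

theorem measurable_loss1 (θ : F.ParW) (p : F.Par1) : Measurable (F.loss1 θ p) :=
  Finset.measurable_fun_sum Finset.univ fun j _ =>
    (((measurable_ψW_apply θ j).comp measurable_fst).sub
      ((measurable_pred1_apply p j).comp measurable_snd)).pow_const 2

theorem measurable_loss2 (q : F.Par2) (p : F.Par1) : Measurable (F.loss2 q p) :=
  (measurable_fst.sub ((measurable_pred2 q p).comp measurable_snd)).pow_const 2

theorem continuous_coef (a : 𝒜) (j : Fin F.dψW) : Continuous fun q : F.Par2 => F.coef q a j :=
  continuous_finsetSum _ fun i _ => ((continuous_apply (i, j)).comp continuous_fst).mul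
    ((continuous_apply i).comp ((F.continuous_ψA a).comp continuous_snd))

theorem continuous_ψW_apply (w : 𝒲) (j : Fin F.dψW) : Continuous fun θ => F.ψW θ w j :=
  (continuous_apply j).comp (F.continuous_ψW w)

theorem continuous_pred1_apply (a : 𝒜) (z : 𝒵) (j : Fin F.dψW) :
    Continuous fun p : F.Par1 => F.pred1 p a z j :=
  continuous_finsetSum _ fun k _ => (continuous_fst.matrix_elem j k).mul
    (((continuous_apply k.1).comp ((F.continuous_φA a).comp continuous_snd.fst)).mul
      ((continuous_apply k.2).comp ((F.continuous_φZ z).comp continuous_snd.snd)))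

theorem continuous_bridge (x : 𝒜 × 𝒲) :
    Continuous fun r : F.Par2 × F.ParW => F.bridge r.1 r.2 x := by
  simp_rw [bridge_eq_coef_dotProduct]
  exact continuous_finsetSum _ fun j _ => ((continuous_coef x.1 j).comp continuous_fst).mul
    ((continuous_ψW_apply x.2 j).comp continuous_snd)

theorem continuous_loss1 (x : 𝒲 × 𝒜 × 𝒵) :
    Continuous fun r : F.ParW × F.Par1 => F.loss1 r.1 r.2 x :=
  continuous_finsetSum Finset.univ fun j _ => (((continuous_ψW_apply x.1 j).comp
    continuous_fst).sub ((continuous_pred1_apply x.2.1 x.2.2 j).comp continuous_snd)).pow 2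

theorem continuous_loss2 (x : ℝ × 𝒜 × 𝒵) :
    Continuous fun r : F.Par2 × F.Par1 => F.loss2 r.1 r.2 x := by
  simp_rw [loss2, pred2_eq_coef_dotProduct]
  exact (continuous_const.sub (continuous_finsetSum Finset.univ fun j _ =>
    ((continuous_coef x.2.1 j).comp continuous_fst).mul
      ((continuous_pred1_apply x.2.1 x.2.2 j).comp continuous_snd))).pow 2

theorem abs_loss1_le (hF : F.Bounded M) (hθ : θ ∈ F.ΘW) (hp : p ∈ F.stage1) (x : 𝒲 × 𝒜 × 𝒵) :
    |F.loss1 θ p x| ≤ 4 := by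
  rw [loss1, abs_of_nonneg (sqNorm_nonneg _)]
  linarith [sqNorm_sub_le (F.ψW θ x.1) (F.pred1 p x.2.1 x.2.2), hF.1 p hp x.2.1 x.2.2,
    hF.2.1 θ hθ x.1]

theorem abs_ψW_apply_le (hF : F.Bounded M) (hθ : θ ∈ F.ΘW) (w : 𝒲) (j : Fin F.dψW) :
    |F.ψW θ w j| ≤ 1 := by
  simpa using abs_apply_le_of_sqNorm_le (M := 1) (by simpa using hF.2.1 θ hθ w) j

theorem abs_pred1_apply_le (hF : F.Bounded M) (hp : p ∈ F.stage1) (a : 𝒜) (z : 𝒵)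
    (j : Fin F.dψW) : |F.pred1 p a z j| ≤ 1 := by
  simpa using abs_apply_le_of_sqNorm_le (M := 1) (by simpa using hF.1 p hp a z) j

theorem sqNorm_coef_le (hF : F.Bounded M) (hq : q ∈ F.stage2) (a : 𝒜) :
    sqNorm (F.coef q a) ≤ M ^ 2 :=
  hF.2.2 q hq a

theorem abs_pred2_le (hF : F.Bounded M) (hq : q ∈ F.stage2) (hp : p ∈ F.stage1) (a : 𝒜) (z : 𝒵) :
    |F.pred2 q p a z| ≤ |M| := by
  rw [pred2_eq_coef_dotProduct]
  exact abs_dotProduct_le (sqNorm_coef_le hF hq a) (hF.1 p hp a z)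

theorem abs_bridge_le (hF : F.Bounded M) (hq : q ∈ F.stage2) (hθ : θ ∈ F.ΘW) (x : 𝒜 × 𝒲) :
    |F.bridge q θ x| ≤ |M| := by
  rw [bridge_eq_coef_dotProduct]
  exact abs_dotProduct_le (sqNorm_coef_le hF hq x.1) (hF.2.1 θ hθ x.2)

theorem abs_loss2_le (hF : F.Bounded M) (hq : q ∈ F.stage2) (hp : p ∈ F.stage1)
    (x : ℝ × 𝒜 × 𝒵) : |F.loss2 q p x| ≤ (|x.1| + |M|) ^ 2 := by
  rw [loss2, abs_pow]
  exact pow_le_pow_left₀ (abs_nonneg _)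
    ((abs_sub _ _).trans (add_le_add_right (abs_pred2_le hF hq hp _ _) _)) 2

end FeatureModel

theorem le_add_sqrt_of_sq_le_sq_add {x a b : ℝ} (ha : 0 ≤ a) (h : x ^ 2 ≤ a ^ 2 + b) :
    x ≤ a + √b := by
  by_contra! hlt
  have hxa : √b < x - a := lt_sub_iff_add_lt'.2 hlt
  have hb : b < (x - a) ^ 2 := (Real.sqrt_lt' ((Real.sqrt_nonneg b).trans_lt hxa)).1 hxa
  nlinarith [Real.sqrt_nonneg b]

theorem le_add_of_isMinOn_of_abs_sub_le {T : Type*} {s : Set T} {t t₀ : T}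
    {risk emp pen : T → ℝ} {Δ ε : ℝ} (hΔ : ∀ t ∈ s, |risk t - emp t| ≤ Δ) (hpen₀ : 0 ≤ pen t₀)
    (hpen : pen t ≤ ε) (hmin : IsMinOn (fun t => emp t + pen t) s t₀) (ht₀ : t₀ ∈ s)
    (ht : t ∈ s) : risk t₀ ≤ risk t + (2 * Δ + ε) := by
  linarith [(abs_le.1 (hΔ t₀ ht₀)).2, (abs_le.1 (hΔ t ht)).1, isMinOn_iff.1 hmin t ht]

namespace FeatureModel

variable {𝒜 𝒵 𝒲 Ω 𝒰 𝒞 : Type*} [MeasurableSpace 𝒜] [MeasurableSpace 𝒵] [MeasurableSpace 𝒲]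
  [MeasurableSpace Ω] [MeasurableSpace 𝒰] [MeasurableSpace 𝒞] {F : FeatureModel 𝒜 𝒵 𝒲}
  {P : Population Ω 𝒰 𝒜 𝒵 𝒲 𝒞} {M ε Δ D lam : ℝ} {q : F.Par2} {p : F.Par1} {θ : F.ParW}
  {est : F.ParW → F.Par1} {r : F.Par2 × F.ParW}

/-- The conditional mean of the `j`-th feature of `W`, the population target of stage 1. -/
noncomputable def featMean (F : FeatureModel 𝒜 𝒵 𝒲) (P : Population Ω 𝒰 𝒜 𝒵 𝒲 𝒞) (θ : F.ParW)
    (j : Fin F.dψW) : Ω → ℝ :=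
  P.μ[fun ω => F.ψW θ (P.W ω) j | P.sigmaAZ]

/-- The stage 1 excess risk, the squared `L²` distance from `E[ψ_{θ_W}(W) | A, Z]` to a stage 1
prediction. -/
noncomputable def excessRisk (F : FeatureModel 𝒜 𝒵 𝒲) (P : Population Ω 𝒰 𝒜 𝒵 𝒲 𝒞)
    (θ : F.ParW) (p : F.Par1) : ℝ :=
  ∫ ω, ∑ j, (F.featMean P θ j ω - F.pred1 p (P.A ω) (P.Z ω) j) ^ 2 ∂P.μ

/-- The conditional mean `E[h(A, W) | A, Z]` of a bridge function of the model. -/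
noncomputable def bridgeCondMean (F : FeatureModel 𝒜 𝒵 𝒲) (P : Population Ω 𝒰 𝒜 𝒵 𝒲 𝒞)
    (r : F.Par2 × F.ParW) : Ω → ℝ :=
  P.μ[fun ω => F.bridge r.1 r.2 (P.A ω, P.W ω) | P.sigmaAZ]

/-- The `L²` distance from `E[Y | A, Z]` to `E[h(A, W) | A, Z]`, for a bridge function `h` of the
model. -/
noncomputable def bridgeDist (F : FeatureModel 𝒜 𝒵 𝒲) (P : Population Ω 𝒰 𝒜 𝒵 𝒲 𝒞)
    (r : F.Par2 × F.ParW) : ℝ :=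
  lpNorm (P.μ[P.Y | P.sigmaAZ] - F.bridgeCondMean P r) 2 P.μ

/-- The `L²` distance from `E[Y | A, Z]` to a stage 2 prediction. -/
noncomputable def pred2Dist (F : FeatureModel 𝒜 𝒵 𝒲) (P : Population Ω 𝒰 𝒜 𝒵 𝒲 𝒞)
    (q : F.Par2) (p : F.Par1) : ℝ :=
  lpNorm (P.μ[P.Y | P.sigmaAZ] - fun ω => F.pred2 q p (P.A ω) (P.Z ω)) 2 P.μ

theorem memLp_ψW (hF : F.Bounded M) (hθ : θ ∈ F.ΘW) (j : Fin F.dψW) :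
    MemLp (fun ω => F.ψW θ (P.W ω) j) 2 P.μ :=
  .of_bound ((measurable_ψW_apply θ j).comp P.measurable_W).aestronglyMeasurable 1
    (ae_of_all _ fun _ => abs_ψW_apply_le hF hθ _ j)

theorem memLp_featMean (hF : F.Bounded M) (hθ : θ ∈ F.ΘW) (j : Fin F.dψW) :
    MemLp (F.featMean P θ j) 2 P.μ :=
  (memLp_ψW hF hθ j).condExp one_le_two

theorem memLp_pred1 (hF : F.Bounded M) (hp : p ∈ F.stage1) (j : Fin F.dψW) :
    MemLp (fun ω => F.pred1 p (P.A ω) (P.Z ω) j) 2 P.μ :=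
  .of_bound ((measurable_pred1_apply p j).comp
    (P.measurable_A.prodMk P.measurable_Z)).aestronglyMeasurable 1
    (ae_of_all _ fun _ => abs_pred1_apply_le hF hp _ _ j)

theorem memLp_pred2 (hF : F.Bounded M) (hq : q ∈ F.stage2) (hp : p ∈ F.stage1) :
    MemLp (fun ω => F.pred2 q p (P.A ω) (P.Z ω)) 2 P.μ :=
  .of_bound ((measurable_pred2 q p).comp
    (P.measurable_A.prodMk P.measurable_Z)).aestronglyMeasurable |M|
    (ae_of_all _ fun _ => abs_pred2_le hF hq hp _ _)

theorem memLp_bridge (hF : F.Bounded M) (hr : r ∈ F.stage2 ×ˢ F.ΘW) :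
    MemLp (fun ω => F.bridge r.1 r.2 (P.A ω, P.W ω)) 2 P.μ :=
  .of_bound ((measurable_bridge r.1 r.2).comp
    (P.measurable_A.prodMk P.measurable_W)).aestronglyMeasurable |M|
    (ae_of_all _ fun _ => abs_bridge_le hF hr.1 hr.2 _)

theorem memLp_bridgeCondMean (hF : F.Bounded M) (hr : r ∈ F.stage2 ×ˢ F.ΘW) :
    MemLp (F.bridgeCondMean P r) 2 P.μ :=
  (memLp_bridge hF hr).condExp one_le_two

theorem excessRisk_nonneg (θ : F.ParW) (p : F.Par1) : 0 ≤ F.excessRisk P θ p :=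
  integral_nonneg fun _ => Finset.sum_nonneg fun _ _ => sq_nonneg _

theorem integrable_sq_featMean_sub_pred1 (hF : F.Bounded M) (hθ : θ ∈ F.ΘW) (hp : p ∈ F.stage1)
    (j : Fin F.dψW) :
    Integrable (fun ω => (F.featMean P θ j ω - F.pred1 p (P.A ω) (P.Z ω) j) ^ 2) P.μ :=
  ((memLp_featMean hF hθ j).sub (memLp_pred1 hF hp j)).integrable_sq

theorem integral_loss1_eq_excessRisk_add (hF : F.Bounded M) (hθ : θ ∈ F.ΘW)
    (hp : p ∈ F.stage1) :
    ∫ ω, F.loss1 θ p (P.W ω, P.A ω, P.Z ω) ∂P.μ = F.excessRisk P θ p +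
      ∑ j, ∫ ω, (F.ψW θ (P.W ω) j - F.featMean P θ j ω) ^ 2 ∂P.μ := by
  have hint (j) : Integrable (fun ω => (F.ψW θ (P.W ω) j - F.pred1 p (P.A ω) (P.Z ω) j) ^ 2) P.μ :=
    ((memLp_ψW hF hθ j).sub (memLp_pred1 hF hp j)).integrable_sq
  simp only [loss1, sqNorm, excessRisk, Pi.sub_apply]
  rw [integral_finsetSum _ fun j _ => hint j,
    integral_finsetSum _ fun j _ => integrable_sq_featMean_sub_pred1 hF hθ hp j,
    ← Finset.sum_add_distrib]
  exact Finset.sum_congr rfl fun j _ => integral_sub_sq_eq_add Population.sigmaAZ_le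
    (memLp_ψW hF hθ j) (memLp_pred1 hF hp j)
    (Population.stronglyMeasurable_comp_AZ (measurable_pred1_apply p j))

theorem excessRisk_le_four (hF : F.Bounded M) (hθ : θ ∈ F.ΘW) (hp : p ∈ F.stage1) :
    F.excessRisk P θ p ≤ 4 := by
  have hnoise : 0 ≤ ∑ j, ∫ ω, (F.ψW θ (P.W ω) j - F.featMean P θ j ω) ^ 2 ∂P.μ :=
    Finset.sum_nonneg fun j _ => integral_nonneg fun _ => sq_nonneg _
  calc F.excessRisk P θ p ≤ ∫ ω, F.loss1 θ p (P.W ω, P.A ω, P.Z ω) ∂P.μ := by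
        rw [integral_loss1_eq_excessRisk_add hF hθ hp]
        exact le_add_of_nonneg_right hnoise
    _ ≤ 4 := (le_abs_self _).trans
        (abs_integral_le fun _ => abs_loss1_le hF hθ hp _)

theorem kappa1_nonneg : 0 ≤ F.kappa1 P :=
  Real.iSup_nonneg fun _ => Real.iInf_nonneg fun _ => excessRisk_nonneg _ _

theorem iInf_excessRisk_le_kappa1 [Nonempty F.stage1] (hF : F.Bounded M) (hθ : θ ∈ F.ΘW) :
    ⨅ p : F.stage1, F.excessRisk P θ p ≤ F.kappa1 P := by
  have hbdd : BddAbove (Set.range fun θ : F.ΘW => ⨅ p : F.stage1, F.excessRisk P θ p) := by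
    refine ⟨4, Set.forall_mem_range.2 fun θ' => ?_⟩
    obtain ⟨p⟩ := ‹Nonempty F.stage1›
    exact ciInf_le_of_le ⟨0, Set.forall_mem_range.2 fun _ => excessRisk_nonneg _ _⟩ p
      (excessRisk_le_four hF θ'.2 p.2)
  exact le_ciSup hbdd ⟨θ, hθ⟩

theorem excessRisk_le_of_isStage1Minimizer {m : ℕ} {S : Fin m → 𝒲 × 𝒜 × 𝒵}
    (hF : F.Bounded M) (hest : F.IsStage1Minimizer S lam est) (hlam : 0 ≤ lam)
    (hreg : ∀ p ∈ F.stage1, lam * sqFrob p.1 ≤ ε)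
    (hΔ : ∀ θ ∈ F.ΘW, ∀ p ∈ F.stage1,
      |∫ ω, F.loss1 θ p (P.W ω, P.A ω, P.Z ω) ∂P.μ - avg fun i => F.loss1 θ p (S i)| ≤ Δ)
    (hθ : θ ∈ F.ΘW) : F.excessRisk P θ (est θ) ≤ F.kappa1 P + (2 * Δ + ε) := by
  obtain ⟨hmem, hmin⟩ := hest θ hθ
  have : Nonempty F.stage1 := ⟨⟨_, hmem⟩⟩
  rw [← sub_le_iff_le_add]
  refine (le_ciInf fun p => ?_).trans (iInf_excessRisk_le_kappa1 hF hθ)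
  have hrisk := le_add_of_isMinOn_of_abs_sub_le (hΔ θ hθ) (mul_nonneg hlam (sqFrob_nonneg _))
    (hreg p p.2) hmin hmem p.2
  rw [integral_loss1_eq_excessRisk_add hF hθ hmem,
    integral_loss1_eq_excessRisk_add hF hθ p.2] at hrisk
  linarith

theorem bridgeCondMean_ae_eq (hF : F.Bounded M) (hq : q ∈ F.stage2) (hθ : θ ∈ F.ΘW) :
    F.bridgeCondMean P (q, θ) =ᵐ[P.μ]
      fun ω => F.coef q (P.A ω) ⬝ᵥ fun j => F.featMean P θ j ω := by
  have hcoef (j) : MemLp (fun ω => F.coef q (P.A ω) j) 2 P.μ :=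
    .of_bound ((measurable_coef q j).comp P.measurable_A).aestronglyMeasurable |M|
      (ae_of_all _ fun ω => abs_apply_le_of_sqNorm_le (sqNorm_coef_le hF hq (P.A ω)) j)
  have hint (j) : Integrable (fun ω => F.coef q (P.A ω) j * F.ψW θ (P.W ω) j) P.μ :=
    (hcoef j).integrable_mul (memLp_ψW hF hθ j)
  have hsum : (fun ω => F.bridge q θ (P.A ω, P.W ω)) =
      ∑ j, fun ω => F.coef q (P.A ω) j * F.ψW θ (P.W ω) j := by
    ext ω
    rw [bridge_eq_coef_dotProduct, Finset.sum_apply]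
    rfl
  have hpull : ∀ᵐ ω ∂P.μ, ∀ j,
      (P.μ[fun ω => F.coef q (P.A ω) j * F.ψW θ (P.W ω) j | P.sigmaAZ]) ω =
        F.coef q (P.A ω) j * F.featMean P θ j ω :=
    ae_all_iff.2 fun j => condExp_mul_of_stronglyMeasurable_left
      (Population.stronglyMeasurable_comp_AZ ((measurable_coef q j).comp measurable_fst))
      (hint j) ((memLp_ψW hF hθ j).integrable one_le_two)
  rw [bridgeCondMean, hsum]
  filter_upwards [condExp_finsetSum (s := Finset.univ) (fun j _ => hint j) P.sigmaAZ, hpull]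
    with ω hω hpullω
  rw [hω, Finset.sum_apply]
  exact Finset.sum_congr rfl fun j _ => hpullω j

theorem lpNorm_bridgeCondMean_sub_pred2_le (hF : F.Bounded M) (hq : q ∈ F.stage2)
    (hθ : θ ∈ F.ΘW) (hp : p ∈ F.stage1) :
    lpNorm (F.bridgeCondMean P (q, θ) - fun ω => F.pred2 q p (P.A ω) (P.Z ω)) 2 P.μ ≤
      |M| * √(F.excessRisk P θ p) := by
  rw [lpNorm_two_eq_sqrt_integral_sq
      ((memLp_bridgeCondMean hF ⟨hq, hθ⟩).sub (memLp_pred2 hF hq hp)).1,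
    ← Real.sqrt_sq_eq_abs, ← Real.sqrt_mul (sq_nonneg M), excessRisk, ← integral_const_mul]
  refine Real.sqrt_le_sqrt (integral_mono_of_nonneg (ae_of_all _ fun _ => sq_nonneg _)
    ((integrable_finsetSum _ fun j _ =>
      integrable_sq_featMean_sub_pred1 hF hθ hp j).const_mul _) ?_)
  filter_upwards [bridgeCondMean_ae_eq (P := P) hF hq hθ] with ω hω
  rw [Pi.sub_apply, hω, pred2_eq_coef_dotProduct, ← dotProduct_sub]
  exact (dotProduct_sq_le _ _).trans
    (mul_le_mul_of_nonneg_right (sqNorm_coef_le hF hq _) (sqNorm_nonneg _))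

theorem integral_loss2_eq_pred2Dist_sq_add (hF : F.Bounded M) (hY : ∀ᵐ ω ∂P.μ, |P.Y ω| ≤ M)
    (hq : q ∈ F.stage2) (hp : p ∈ F.stage1) :
    ∫ ω, F.loss2 q p (P.Y ω, P.A ω, P.Z ω) ∂P.μ =
      F.pred2Dist P q p ^ 2 + ∫ ω, (P.Y ω - (P.μ[P.Y | P.sigmaAZ]) ω) ^ 2 ∂P.μ := by
  have hY₂ := Population.memLp_Y hY
  have hpred : MemLp (fun ω => F.pred2 q p (P.A ω) (P.Z ω)) 2 P.μ := memLp_pred2 hF hq hp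
  rw [pred2Dist, lpNorm_two_eq_sqrt_integral_sq ((hY₂.condExp one_le_two).sub hpred).1,
    Real.sq_sqrt (integral_nonneg fun _ => sq_nonneg _)]
  exact integral_sub_sq_eq_add Population.sigmaAZ_le hY₂ hpred
    (Population.stronglyMeasurable_comp_AZ (measurable_pred2 q p))

theorem kappa2_eq_iInf_bridgeDist :
    F.kappa2 P = ⨅ r : (F.stage2 ×ˢ F.ΘW : Set (F.Par2 × F.ParW)), F.bridgeDist P r :=
  iInf_congr fun r => (lpNorm_two_eq_sqrt_integral_sq (integrable_condExp.sub
    (integrable_condExp (f := fun ω => F.bridge r.1.1 r.1.2 (P.A ω, P.W ω)))).1).symm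

theorem kappa2_nonneg : 0 ≤ F.kappa2 P :=
  Real.iInf_nonneg fun _ => Real.sqrt_nonneg _

theorem pred2Dist_le_of_isStage2Minimizer {n : ℕ} {S : Fin n → ℝ × 𝒜 × 𝒵} (hF : F.Bounded M)
    (hY : ∀ᵐ ω ∂P.μ, |P.Y ω| ≤ M) (hmin : F.IsStage2Minimizer S lam est r)
    (hest : ∀ θ ∈ F.ΘW, est θ ∈ F.stage1) (hlam : 0 ≤ lam)
    (hreg : ∀ q ∈ F.stage2, lam * sqNorm q.1 ≤ ε)
    (hΔ : ∀ q ∈ F.stage2, ∀ p ∈ F.stage1,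
      |∫ ω, F.loss2 q p (P.Y ω, P.A ω, P.Z ω) ∂P.μ - avg fun i => F.loss2 q p (S i)| ≤ Δ)
    (hq : q ∈ F.stage2) (hθ : θ ∈ F.ΘW) :
    F.pred2Dist P r.1 (est r.2) ≤ F.pred2Dist P q (est θ) + √(2 * Δ + ε) := by
  have hrisk := le_add_of_isMinOn_of_abs_sub_le (s := F.stage2 ×ˢ F.ΘW) (t := (q, θ))
    (risk := fun r => ∫ ω, F.loss2 r.1 (est r.2) (P.Y ω, P.A ω, P.Z ω) ∂P.μ)
    (pen := fun r => lam * sqNorm r.1.1)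
    (fun r hr => hΔ r.1 hr.1 _ (hest r.2 hr.2)) (mul_nonneg hlam (sqNorm_nonneg _)) (hreg q hq)
    hmin.2 hmin.1 ⟨hq, hθ⟩
  simp only [integral_loss2_eq_pred2Dist_sq_add hF hY hmin.1.1 (hest _ hmin.1.2),
    integral_loss2_eq_pred2Dist_sq_add hF hY hq (hest _ hθ)] at hrisk
  exact le_add_sqrt_of_sq_le_sq_add lpNorm_nonneg (by linarith)

theorem abs_bridgeDist_sub_pred2Dist_le (hF : F.Bounded M) (hY : ∀ᵐ ω ∂P.μ, |P.Y ω| ≤ M)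
    (hq : q ∈ F.stage2) (hθ : θ ∈ F.ΘW) (hp : p ∈ F.stage1) :
    |F.bridgeDist P (q, θ) - F.pred2Dist P q p| ≤ |M| * √(F.excessRisk P θ p) := by
  have hEY : MemLp (P.μ[P.Y | P.sigmaAZ]) 2 P.μ := (Population.memLp_Y hY).condExp one_le_two
  have hb : MemLp (F.bridgeCondMean P (q, θ)) 2 P.μ := memLp_bridgeCondMean hF ⟨hq, hθ⟩
  have hpred : MemLp (fun ω => F.pred2 q p (P.A ω) (P.Z ω)) 2 P.μ := memLp_pred2 hF hq hp
  refine le_trans ?_ (lpNorm_bridgeCondMean_sub_pred2_le hF hq hθ hp)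
  rw [abs_sub_le_iff, sub_le_iff_le_add', sub_le_iff_le_add']
  refine ⟨?_, lpNorm_sub_le_lpNorm_sub_add_lpNorm_sub hEY hb one_le_two⟩
  rw [lpNorm_sub_comm (F.bridgeCondMean P (q, θ))]
  exact lpNorm_sub_le_lpNorm_sub_add_lpNorm_sub hEY hpred one_le_two

theorem bridgeDist_le_of_isStage2Minimizer {n : ℕ} {S : Fin n → ℝ × 𝒜 × 𝒵} (hF : F.Bounded M)
    (hY : ∀ᵐ ω ∂P.μ, |P.Y ω| ≤ M) (hmin : F.IsStage2Minimizer S lam est r)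
    (hest : ∀ θ ∈ F.ΘW, est θ ∈ F.stage1) (hD : ∀ θ ∈ F.ΘW, F.excessRisk P θ (est θ) ≤ D)
    (hlam : 0 ≤ lam) (hreg : ∀ q ∈ F.stage2, lam * sqNorm q.1 ≤ ε)
    (hΔ : ∀ q ∈ F.stage2, ∀ p ∈ F.stage1,
      |∫ ω, F.loss2 q p (P.Y ω, P.A ω, P.Z ω) ∂P.μ - avg fun i => F.loss2 q p (S i)| ≤ Δ) :
    F.bridgeDist P r ≤ F.kappa2 P + 2 * (|M| * √D) + √(2 * Δ + ε) := by
  have happrox (r : F.Par2 × F.ParW) (hr : r ∈ F.stage2 ×ˢ F.ΘW) :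
      |F.bridgeDist P r - F.pred2Dist P r.1 (est r.2)| ≤ |M| * √D :=
    (abs_bridgeDist_sub_pred2Dist_le hF hY hr.1 hr.2 (hest _ hr.2)).trans
      (mul_le_mul_of_nonneg_left (Real.sqrt_le_sqrt (hD _ hr.2)) (abs_nonneg M))
  have : Nonempty (F.stage2 ×ˢ F.ΘW : Set (F.Par2 × F.ParW)) := ⟨⟨r, hmin.1⟩⟩
  rw [add_assoc, ← sub_le_iff_le_add, kappa2_eq_iInf_bridgeDist]
  refine le_ciInf fun r' => ?_
  linarith [(abs_le.1 (happrox r hmin.1)).2, (abs_le.1 (happrox r' r'.2)).1,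
    pred2Dist_le_of_isStage2Minimizer hF hY hmin hest hlam hreg hΔ r'.2.1 r'.2.2]

end FeatureModel

namespace FeatureModel

variable {𝒜 𝒵 𝒲 Ω 𝒰 𝒞 Ω' : Type*} [MeasurableSpace 𝒜] [MeasurableSpace 𝒵] [MeasurableSpace 𝒲]
  [MeasurableSpace Ω] [MeasurableSpace 𝒰] [MeasurableSpace 𝒞] [MeasurableSpace Ω']
  {F : FeatureModel 𝒜 𝒵 𝒲} {P : Population Ω 𝒰 𝒜 𝒵 𝒲 𝒞} {Q : Measure Ω'}
  [IsProbabilityMeasure Q] {M η : ℝ} {n : ℕ} [NeZero n]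

-- `Par1` contains a space of matrices, which carries its product topology but not the instances
-- of a function space.
instance : SecondCountableTopology F.Par1 :=
  inferInstanceAs (SecondCountableTopology
    ((Fin F.dψW → Fin F.dφA × Fin F.dφZ → ℝ) × (Fin F.pφA → ℝ) × (Fin F.pφZ → ℝ)))

theorem range_loss1 :
    (Set.range fun t : (F.ΘW ×ˢ F.stage1 : Set _) => F.loss1 t.1.1 t.1.2) = F.H1 := by
  ext g
  simp only [Set.mem_range, Subtype.exists, Prod.exists, Set.mem_prod, H1, Set.mem_ofPred_eq]
  grind

theorem range_loss2 :
    (Set.range fun t : (F.stage2 ×ˢ F.stage1 : Set _) => F.loss2 t.1.1 t.1.2) = F.H2 := by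
  ext g
  simp only [Set.mem_range, Subtype.exists, Prod.exists, Set.mem_prod, H2, Set.mem_ofPred_eq]
  grind

theorem empRademacher_H1_nonneg (hF : F.Bounded M) (S : Fin n → 𝒲 × 𝒜 × 𝒵) :
    0 ≤ empRademacher F.H1 S := by
  refine empRademacher_nonneg (B := 4) ?_
  rintro _ ⟨θ, hθ, p, hp, rfl⟩ j
  exact abs_loss1_le hF hθ hp _

theorem empRademacher_H2_nonneg (hF : F.Bounded M) (S : Fin n → ℝ × 𝒜 × 𝒵) :
    0 ≤ empRademacher F.H2 S := by
  refine empRademacher_nonneg (B := ((∑ j, |(S j).1|) + |M|) ^ 2) ?_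
  rintro _ ⟨q, hq, p, hp, rfl⟩ j
  refine (abs_loss2_le hF hq hp _).trans ?_
  gcongr
  exact Finset.single_le_sum (f := fun j => |(S j).1|) (fun _ _ => abs_nonneg _) (Finset.mem_univ j)

theorem measure_exists_lt_abs_loss1_deviation_le (hF : F.Bounded M)
    {S : Fin n → Ω' → 𝒲 × 𝒜 × 𝒵}
    (hS : IsIIDSample Q (P.μ.map fun ω => (P.W ω, P.A ω, P.Z ω)) S) (hη : 0 < η) :
    Q {ω | ∃ θ ∈ F.ΘW, ∃ p ∈ F.stage1,
      2 * empRademacher F.H1 (fun i => S i ω) + deviationConst 4 η * (1 / √n) <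
        |∫ ω', F.loss1 θ p (P.W ω', P.A ω', P.Z ω') ∂P.μ - avg fun i => F.loss1 θ p (S i ω)|} ≤
      ENNReal.ofReal η := by
  have hX : Measurable fun ω => (P.W ω, P.A ω, P.Z ω) :=
    P.measurable_W.prodMk (P.measurable_A.prodMk P.measurable_Z)
  have := Measure.isProbabilityMeasure_map (μ := P.μ) hX.aemeasurable
  have hdev := hS.measure_exists_lt_abs_deviation_le
    (f := fun t : (F.ΘW ×ˢ F.stage1 : Set _) => F.loss1 t.1.1 t.1.2)
    (fun _ => measurable_loss1 _ _) (fun x => (continuous_loss1 x).comp continuous_subtype_val)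
    four_pos (ae_of_all _ fun x t => abs_loss1_le hF t.2.1 t.2.2 x) hη
  simp only [range_loss1, integral_map hX.aemeasurable
    (measurable_loss1 _ _).aestronglyMeasurable] at hdev
  refine (measure_mono ?_).trans hdev
  rintro ω ⟨θ, hθ, p, hp, h⟩
  exact ⟨⟨(θ, p), hθ, hp⟩, h⟩

theorem measure_exists_lt_abs_loss2_deviation_le (hF : F.Bounded M)
    (hY : ∀ᵐ ω ∂P.μ, |P.Y ω| ≤ M) {S : Fin n → Ω' → ℝ × 𝒜 × 𝒵}
    (hS : IsIIDSample Q (P.μ.map fun ω => (P.Y ω, P.A ω, P.Z ω)) S) (hη : 0 < η) :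
    Q {ω | ∃ q ∈ F.stage2, ∃ p ∈ F.stage1,
      2 * empRademacher F.H2 (fun i => S i ω) + deviationConst (4 * M ^ 2 + 1) η * (1 / √n) <
        |∫ ω', F.loss2 q p (P.Y ω', P.A ω', P.Z ω') ∂P.μ - avg fun i => F.loss2 q p (S i ω)|} ≤
      ENNReal.ofReal η := by
  have hX : Measurable fun ω => (P.Y ω, P.A ω, P.Z ω) :=
    P.measurable_Y.prodMk (P.measurable_A.prodMk P.measurable_Z)
  have := Measure.isProbabilityMeasure_map (μ := P.μ) hX.aemeasurable
  have hYmap : ∀ᵐ x ∂(P.μ.map fun ω => (P.Y ω, P.A ω, P.Z ω)), |x.1| ≤ M :=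
    (ae_map_iff hX.aemeasurable (measurableSet_le measurable_fst.abs measurable_const)).2 hY
  have hbound : ∀ᵐ x ∂(P.μ.map fun ω => (P.Y ω, P.A ω, P.Z ω)),
      ∀ t : (F.stage2 ×ˢ F.stage1 : Set _), |F.loss2 t.1.1 t.1.2 x| ≤ 4 * M ^ 2 + 1 := by
    filter_upwards [hYmap] with x hx t
    have hloss := abs_loss2_le hF t.2.1 t.2.2 x
    rw [abs_of_nonneg ((abs_nonneg _).trans hx)] at hloss
    nlinarith [abs_nonneg x.1]
  have hdev := hS.measure_exists_lt_abs_deviation_le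
    (f := fun t : (F.stage2 ×ˢ F.stage1 : Set _) => F.loss2 t.1.1 t.1.2)
    (fun _ => measurable_loss2 _ _) (fun x => (continuous_loss2 x).comp continuous_subtype_val)
    (by positivity) hbound hη
  simp only [range_loss2, integral_map hX.aemeasurable
    (measurable_loss2 _ _).aestronglyMeasurable] at hdev
  refine (measure_mono ?_).trans hdev
  rintro ω ⟨q, hq, p, hp, h⟩
  exact ⟨⟨(q, p), hq, hp⟩, h⟩

theorem measure_lt_abs_integral_bridge_sub_estValue_le (hF : F.Bounded M)
    {S : Fin n → Ω' → 𝒞 × 𝒲} (hS : IsIIDSample Q (P.μ.map fun ω => (P.C ω, P.W ω)) S)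
    {π : 𝒞 → 𝒜} (hπ : Measurable π) {r : Ω' → F.Par2 × F.ParW} (hr : Measurable r)
    (hind : IndepFun r (fun ω i => S i ω) Q) (hmem : ∀ᵐ ω ∂Q, r ω ∈ F.stage2 ×ˢ F.ΘW)
    (hη : 0 < η) :
    Q {ω | deviationConst (|M| + 1) η * (1 / √n) <
      |∫ ω', F.bridge (r ω).1 (r ω).2 (π (P.C ω'), P.W ω') ∂P.μ -
        F.estValue π (r ω) fun i => S i ω|} ≤ ENNReal.ofReal η := by
  have hX : Measurable fun ω => (P.C ω, P.W ω) := P.measurable_C.prodMk P.measurable_W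
  have := Measure.isProbabilityMeasure_map (μ := P.μ) hX.aemeasurable
  have hm (r : F.Par2 × F.ParW) : Measurable fun x : 𝒞 × 𝒲 => F.bridge r.1 r.2 (π x.1, x.2) :=
    (measurable_bridge r.1 r.2).comp ((hπ.comp measurable_fst).prodMk measurable_snd)
  have hdev := hS.measure_lt_abs_heldOut_deviation_le
    (φ := fun (r : F.Par2 × F.ParW) x => F.bridge r.1 r.2 (π x.1, x.2)) (B := |M| + 1)
    (measurable_uncurry_of_continuous_of_measurable
      (fun x => continuous_bridge (π x.1, x.2)) hm) hr hind (by positivity)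
    (hmem.mono fun ω hω => ae_of_all _ fun x =>
      (abs_bridge_le hF hω.1 hω.2 _).trans (lt_add_one _).le) hη
  simp only [integral_map hX.aemeasurable (hm _).aestronglyMeasurable] at hdev
  exact hdev

end FeatureModel

theorem deviationConst_nonneg {B : ℝ} (hB : 0 ≤ B) (η : ℝ) : 0 ≤ deviationConst B η :=
  div_nonneg (mul_nonneg (by norm_num) hB) (Real.sqrt_nonneg _)

theorem measure_setOf_le_ofReal_of_ae_imp_or {Ω : Type*} [MeasurableSpace Ω] {μ : Measure Ω}
    {b p q r : Ω → Prop} {δ : ℝ} (hδ : 0 ≤ δ) (hb : ∀ᵐ ω ∂μ, b ω → p ω ∨ q ω ∨ r ω)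
    (hp : μ {ω | p ω} ≤ ENNReal.ofReal (δ / 3)) (hq : μ {ω | q ω} ≤ ENNReal.ofReal (δ / 3))
    (hr : μ {ω | r ω} ≤ ENNReal.ofReal (δ / 3)) : μ {ω | b ω} ≤ ENNReal.ofReal δ := by
  have hη : 0 ≤ δ / 3 := by positivity
  calc μ {ω | b ω} ≤ μ ({ω | p ω} ∪ ({ω | q ω} ∪ {ω | r ω})) := measure_mono_ae hb
    _ ≤ ENNReal.ofReal (δ / 3) + (ENNReal.ofReal (δ / 3) + ENNReal.ofReal (δ / 3)) :=
        (measure_union_le _ _).trans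
          (add_le_add hp ((measure_union_le _ _).trans (add_le_add hq hr)))
    _ = ENNReal.ofReal δ := by
        rw [← ENNReal.ofReal_add hη hη, ← ENNReal.ofReal_add hη (add_nonneg hη hη)]
        ring_nf

/-- The constant in front of the rate: `ρ τ` times the constant of the `L²` error of the learned
bridge function, plus that of the held-out average. Each of the three deviation bounds is used at
confidence level `δ / 3`. -/
noncomputable def rateConst (M τ ρ δ : ℝ) : ℝ :=
  ρ * τ * (1 + 2 * (|M| * √(5 + 2 * deviationConst 4 (δ / 3))) +
    √(5 + 2 * deviationConst (4 * M ^ 2 + 1) (δ / 3))) + deviationConst (|M| + 1) (δ / 3)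

theorem sqrt_add_two_mul_add_le {k R c s : ℝ} (hk : 0 ≤ k) (hR : 0 ≤ R) (hc : 0 ≤ c)
    (hs : 0 ≤ s) : √(k + (2 * (2 * R + c * s) + s)) ≤ √(5 + 2 * c) * √(k + R + s) := by
  rw [← Real.sqrt_mul (by positivity)]
  refine Real.sqrt_le_sqrt ?_
  nlinarith [mul_nonneg hc hk, mul_nonneg hc hR]

namespace FeatureModel

variable {Ω 𝒰 𝒜 𝒵 𝒲 𝒞 : Type*} [MeasurableSpace Ω] [MeasurableSpace 𝒰] [MeasurableSpace 𝒜]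
  [MeasurableSpace 𝒵] [MeasurableSpace 𝒲] [MeasurableSpace 𝒞] {P : Population Ω 𝒰 𝒜 𝒵 𝒲 𝒞}
  {F : FeatureModel 𝒜 𝒵 𝒲} {hstar : 𝒜 × 𝒲 → ℝ} {π : 𝒞 → 𝒜} {M c₁ c₂ lam₁ lam₂ : ℝ} {τ ρ : ℝ≥0}
  {m n : ℕ} {S₁ : Fin m → 𝒲 × 𝒜 × 𝒵} {S₂ : Fin n → ℝ × 𝒜 × 𝒵} {est : F.ParW → F.Par1}
  {r : F.Par2 × F.ParW}

theorem bridgeDist_le_of_deviation_le [NeZero m] [NeZero n] (hF : F.Bounded M)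
    (hY : ∀ᵐ ω ∂P.μ, |P.Y ω| ≤ M)
    (hest : F.IsStage1Minimizer S₁ lam₁ est) (hr : F.IsStage2Minimizer S₂ lam₂ est r)
    (hlam₁ : 0 ≤ lam₁) (hreg₁ : ∀ p ∈ F.stage1, lam₁ * sqFrob p.1 ≤ 1 / √m)
    (hlam₂ : 0 ≤ lam₂) (hreg₂ : ∀ q ∈ F.stage2, lam₂ * sqNorm q.1 ≤ 1 / √n)
    (hc₁ : 0 ≤ c₁) (hc₂ : 0 ≤ c₂)
    (hΔ₁ : ∀ θ ∈ F.ΘW, ∀ p ∈ F.stage1,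
      |∫ ω, F.loss1 θ p (P.W ω, P.A ω, P.Z ω) ∂P.μ - avg fun i => F.loss1 θ p (S₁ i)| ≤
        2 * empRademacher F.H1 S₁ + c₁ * (1 / √m))
    (hΔ₂ : ∀ q ∈ F.stage2, ∀ p ∈ F.stage1,
      |∫ ω, F.loss2 q p (P.Y ω, P.A ω, P.Z ω) ∂P.μ - avg fun i => F.loss2 q p (S₂ i)| ≤
        2 * empRademacher F.H2 S₂ + c₂ * (1 / √n)) :
    F.bridgeDist P r ≤ F.kappa2 P
      + 2 * (|M| * (√(5 + 2 * c₁) * √(F.kappa1 P + empRademacher F.H1 S₁ + 1 / √m)))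
      + √(5 + 2 * c₂) * √(empRademacher F.H2 S₂ + 1 / √n) := by
  have hstage1 : √(F.kappa1 P + (2 * (2 * empRademacher F.H1 S₁ + c₁ * (1 / √m)) + 1 / √m)) ≤
      √(5 + 2 * c₁) * √(F.kappa1 P + empRademacher F.H1 S₁ + 1 / √m) :=
    sqrt_add_two_mul_add_le kappa1_nonneg (empRademacher_H1_nonneg hF S₁) hc₁ (by positivity)
  have hstage2 : √(2 * (2 * empRademacher F.H2 S₂ + c₂ * (1 / √n)) + 1 / √n) ≤
      √(5 + 2 * c₂) * √(empRademacher F.H2 S₂ + 1 / √n) := by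
    simpa only [zero_add] using
      sqrt_add_two_mul_add_le le_rfl (empRademacher_H2_nonneg hF S₂) hc₂ (by positivity)
  have hexcess (θ) (hθ : θ ∈ F.ΘW) := excessRisk_le_of_isStage1Minimizer hF hest hlam₁ hreg₁ hΔ₁ hθ
  refine (bridgeDist_le_of_isStage2Minimizer hF hY hr (fun θ hθ => (hest θ hθ).1) hexcess
    hlam₂ hreg₂ hΔ₂).trans ?_
  gcongr

theorem abs_value_sub_integral_bridge_le [StandardBorelSpace Ω] [StandardBorelSpace 𝒲]
    [Nonempty 𝒲] (hS : P.Structural) (hI : P.PolicyVariableIndep) (hC : P.ConfounderComplete)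
    (hB : P.IsBridge hstar) (hY : ∀ᵐ ω ∂P.μ, |P.Y ω| ≤ M) (hF : F.Bounded M)
    (hill : F.illPosedness P hstar ≤ τ) (hπ : Measurable π) (hO : P.Overlap π)
    (hρ : P.PolicyL2 π ρ) (hr : r ∈ F.stage2 ×ˢ F.ΘW) :
    |P.value π - ∫ ω, F.bridge r.1 r.2 (π (P.C ω), P.W ω) ∂P.μ| ≤
      ρ * (τ * F.bridgeDist P r) :=
  Population.abs_value_sub_integral_le hS hI hC hB hY hπ hO hρ (measurable_bridge r.1 r.2)
    (memLp_bridge hF hr)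
    ((le_iSup₂ (f := fun (r : F.Par2 × F.ParW) (_ : r ∈ F.stage2 ×ˢ F.ΘW) =>
      eLpNorm (fun ω => hstar (P.A ω, P.W ω) - F.bridge r.1 r.2 (P.A ω, P.W ω)) 2 P.μ /
        eLpNorm (P.μ[fun ω => hstar (P.A ω, P.W ω) - F.bridge r.1 r.2 (P.A ω, P.W ω) | P.sigmaAZ])
          2 P.μ) r hr).trans hill)

theorem abs_value_sub_le_rateConst_mul_rate {δ b v : ℝ} {n' : ℕ}
    (hval : |P.value π - b| ≤ ρ * (τ * F.bridgeDist P r))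
    (hdist : F.bridgeDist P r ≤ F.kappa2 P
      + 2 * (|M| * (√(5 + 2 * deviationConst 4 (δ / 3)) *
        √(F.kappa1 P + empRademacher F.H1 S₁ + 1 / √m)))
      + √(5 + 2 * deviationConst (4 * M ^ 2 + 1) (δ / 3)) *
        √(empRademacher F.H2 S₂ + 1 / √n))
    (hheld : |b - v| ≤ deviationConst (|M| + 1) (δ / 3) * (1 / √n')) :
    |P.value π - v| ≤ rateConst M τ ρ δ * rate P F S₁ S₂ n' := by
  have hk : 0 ≤ F.kappa2 P := kappa2_nonneg
  have hs₁ := Real.sqrt_nonneg (F.kappa1 P + empRademacher F.H1 S₁ + 1 / √m)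
  have hs₂ := Real.sqrt_nonneg (empRademacher F.H2 S₂ + 1 / √n)
  have hs₃ : 0 ≤ 1 / √n' := by positivity
  have hc : 0 ≤ deviationConst (|M| + 1) (δ / 3) := deviationConst_nonneg (by positivity) _
  set R := rate P F S₁ S₂ n' with hR
  rw [rate] at hR
  calc |P.value π - v| ≤ |P.value π - b| + |b - v| := abs_sub_le _ _ _
    _ ≤ ρ * (τ * F.bridgeDist P r) + deviationConst (|M| + 1) (δ / 3) * (1 / √n') :=
        add_le_add hval hheld
    _ ≤ ρ * (τ * (R + 2 * (|M| * (√(5 + 2 * deviationConst 4 (δ / 3)) * R))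
          + √(5 + 2 * deviationConst (4 * M ^ 2 + 1) (δ / 3)) * R))
          + deviationConst (|M| + 1) (δ / 3) * R := by
        grw [hdist]
        gcongr <;> linarith
    _ = rateConst M τ ρ δ * R := by rw [rateConst]; ring

end FeatureModel

end DFPV

theorem proposition4_general {Ω 𝒰 𝒜 𝒵 𝒲 𝒞 Ω' : Type*} [MeasurableSpace Ω] [StandardBorelSpace Ω]
    [MeasurableSpace 𝒰] [MeasurableSpace 𝒜] [MeasurableSpace 𝒵] [MeasurableSpace 𝒲]
    [StandardBorelSpace 𝒲] [MeasurableSpace 𝒞] [MeasurableSpace Ω'] {M : ℝ} {τ ρ : ℝ≥0} {δ : ℝ}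
    (hδ : 0 < δ) {P : DFPV.Population Ω 𝒰 𝒜 𝒵 𝒲 𝒞} {F : DFPV.FeatureModel 𝒜 𝒵 𝒲}
    {hstar : 𝒜 × 𝒲 → ℝ} {π : 𝒞 → 𝒜} (hS : P.Structural) (hI : P.PolicyVariableIndep)
    (hC : P.ConfounderComplete) (hB : P.IsBridge hstar) (hY : ∀ᵐ ω ∂P.μ, |P.Y ω| ≤ M)
    (hF : F.Bounded M) (hill : F.illPosedness P hstar ≤ τ) (hπ : Measurable π)
    (hO : P.Overlap π) (hρ : P.PolicyL2 π ρ) {m n n' : ℕ} (hm : 0 < m) (hn : 0 < n)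
    (hn' : 0 < n') {Q : Measure Ω'} [IsProbabilityMeasure Q] {S₁ : Fin m → Ω' → 𝒲 × 𝒜 × 𝒵}
    {S₂ : Fin n → Ω' → ℝ × 𝒜 × 𝒵} {S₃ : Fin n' → Ω' → 𝒞 × 𝒲} {lam₁ lam₂ : ℝ}
    {est₁ : Ω' → F.ParW → F.Par1} {est₂ : Ω' → F.Par2 × F.ParW}
    (hS₁ : DFPV.IsIIDSample Q (P.μ.map fun ω => (P.W ω, P.A ω, P.Z ω)) S₁)
    (hS₂ : DFPV.IsIIDSample Q (P.μ.map fun ω => (P.Y ω, P.A ω, P.Z ω)) S₂)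
    (hS₃ : DFPV.IsIIDSample Q (P.μ.map fun ω => (P.C ω, P.W ω)) S₃)
    (hlam₁ : 0 ≤ lam₁) (hreg₁ : ∀ p ∈ F.stage1, lam₁ * DFPV.sqFrob p.1 ≤ 1 / √m)
    (hlam₂ : 0 ≤ lam₂) (hreg₂ : ∀ q ∈ F.stage2, lam₂ * DFPV.sqNorm q.1 ≤ 1 / √n)
    (hest₁ : ∀ᵐ ω ∂Q, F.IsStage1Minimizer (fun i => S₁ i ω) lam₁ (est₁ ω))
    (hest₂ : ∀ᵐ ω ∂Q, F.IsStage2Minimizer (fun i => S₂ i ω) lam₂ (est₁ ω) (est₂ ω))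
    (hmeas : Measurable est₂) (hind : IndepFun est₂ (fun ω i => S₃ i ω) Q) :
    Q {ω | DFPV.rateConst M τ ρ δ * DFPV.rate P F (fun i => S₁ i ω) (fun i => S₂ i ω) n' <
      |P.value π - F.estValue π (est₂ ω) (fun i => S₃ i ω)|} ≤ ENNReal.ofReal δ := by
  obtain ⟨ω₀, -⟩ := hY.exists
  have : Nonempty 𝒲 := ⟨P.W ω₀⟩
  have : NeZero m := ⟨hm.ne'⟩
  have : NeZero n := ⟨hn.ne'⟩
  have : NeZero n' := ⟨hn'.ne'⟩
  have hη : 0 < δ / 3 := by positivity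
  have hdev₁ := DFPV.FeatureModel.measure_exists_lt_abs_loss1_deviation_le hF hS₁ hη
  have hdev₂ := DFPV.FeatureModel.measure_exists_lt_abs_loss2_deviation_le hF hY hS₂ hη
  have hdev₃ := DFPV.FeatureModel.measure_lt_abs_integral_bridge_sub_estValue_le hF hS₃ hπ hmeas
    hind (hest₂.mono fun _ h => h.1) hη
  refine DFPV.measure_setOf_le_ofReal_of_ae_imp_or hδ.le ?_ hdev₁ hdev₂ hdev₃
  filter_upwards [hest₁, hest₂] with ω h₁ h₂
  contrapose!
  rintro ⟨hgood₁, hgood₂, hgood₃⟩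
  exact DFPV.FeatureModel.abs_value_sub_le_rateConst_mul_rate
    (DFPV.FeatureModel.abs_value_sub_integral_bridge_le hS hI hC hB hY hF hill hπ hO hρ h₂.1)
    (DFPV.FeatureModel.bridgeDist_le_of_deviation_le hF hY h₁ h₂ hlam₁ hreg₁ hlam₂ hreg₂
      (DFPV.deviationConst_nonneg (by norm_num) _) (DFPV.deviationConst_nonneg (by positivity) _)
      hgood₁ hgood₂) hgood₃

theorem proposition4 {Ω 𝒰 𝒜 𝒵 𝒲 𝒞 Ω' : Type*} [MeasurableSpace Ω] [StandardBorelSpace Ω]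
    [MeasurableSpace 𝒰] [MeasurableSpace 𝒜] [MeasurableSpace 𝒵]
    [MeasurableSpace 𝒲] [StandardBorelSpace 𝒲] [MeasurableSpace 𝒞] [MeasurableSpace Ω']
    (M : ℝ) (τ ρ : ℝ≥0) (δ : ℝ) (hδ : 0 < δ) :
    ∃ K : ℝ, ∀ (P : DFPV.Population Ω 𝒰 𝒜 𝒵 𝒲 𝒞) (F : DFPV.FeatureModel 𝒜 𝒵 𝒲)
      (hstar : 𝒜 × 𝒲 → ℝ) (π : 𝒞 → 𝒜),
      P.Structural → P.PolicyVariableIndep → P.ConfounderComplete → P.ProxyComplete →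
      P.IsBridge hstar → (∀ᵐ ω ∂P.μ, |P.Y ω| ≤ M) → F.Bounded M →
      F.illPosedness P hstar ≤ τ →
      Measurable π → P.Overlap π → P.PolicyL2 π ρ →
      ∀ (m n n' : ℕ), 0 < m → 0 < n → 0 < n' →
      ∀ (Q : Measure Ω') [IsProbabilityMeasure Q]
        (S₁ : Fin m → Ω' → 𝒲 × 𝒜 × 𝒵) (S₂ : Fin n → Ω' → ℝ × 𝒜 × 𝒵)
        (S₃ : Fin n' → Ω' → 𝒞 × 𝒲)
        (lam₁ lam₂ : ℝ) (est₁ : Ω' → F.ParW → F.Par1) (est₂ : Ω' → F.Par2 × F.ParW),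
        DFPV.IsIIDSample Q (P.μ.map fun ω => (P.W ω, P.A ω, P.Z ω)) S₁ →
        DFPV.IsIIDSample Q (P.μ.map fun ω => (P.Y ω, P.A ω, P.Z ω)) S₂ →
        DFPV.IsIIDSample Q (P.μ.map fun ω => (P.C ω, P.W ω)) S₃ →
        0 ≤ lam₁ → (∀ p ∈ F.stage1, lam₁ * DFPV.sqFrob p.1 ≤ 1 / Real.sqrt m) →
        0 ≤ lam₂ → (∀ q ∈ F.stage2, lam₂ * DFPV.sqNorm q.1 ≤ 1 / Real.sqrt n) →
        (∀ᵐ ω ∂Q, F.IsStage1Minimizer (fun i => S₁ i ω) lam₁ (est₁ ω)) →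
        (∀ᵐ ω ∂Q, F.IsStage2Minimizer (fun i => S₂ i ω) lam₂ (est₁ ω) (est₂ ω)) →
        Measurable est₂ → IndepFun est₂ (fun ω i => S₃ i ω) Q →
        Q {ω | K * DFPV.rate P F (fun i => S₁ i ω) (fun i => S₂ i ω) n' <
            |P.value π - F.estValue π (est₂ ω) (fun i => S₃ i ω)|} ≤ ENNReal.ofReal δ := by
  exact ⟨DFPV.rateConst M τ ρ δ, fun _ _ _ _ hS hI hC _ hB hY hF hill hπ hO hρ _ _ _ hm hn hn' _ _
    _ _ _ _ _ _ _ => proposition4_general hδ hS hI hC hB hY hF hill hπ hO hρ hm hn hn'⟩
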